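/- Let $\sigma\ge 2$ and let $\mathcal T_\sigma$ be the rooted tree in which every vertex has exactly $\sigma$ children, with root $o$. *Invasion percolation cluster (IPC).* Assign i.i.d. weights, uniform on $(0,1)$, to the edges of $\mathcal T_\sigma$. Let $I_0=\{o\}$ and, given $I_N$, let $I_{N+1}$ be obtained by adjoining to $I_N$ the edge in its boundary with smallest weight. The IPC is $C=\bigcup_{N\ge 0} I_N$, regarded as a set of vertices. *Incipient infinite cluster (IIC).* Let $\mathbb P_{p_c}$ be the law of independent bond percolation on $\mathcal T_\sigma$ with the critical parameter $p_c=1/\sigma$, and let $\{o\to n\}$ be the event that $o$ is connected by open edges to a vertex at distance $n$ from $o$. The IIC measure $\mathbb P_\infty$ is the probability measure on bond configurations with $$\mathbb P_\infty(E)=\lim_{n\to\infty}\mathbb P_{p_c}(E\mid o\to n)$$ for every event $E$ that depends on the status of only finitely many edges. The IIC $C_\infty$ is the open cluster of $o$ under $\mathbb P_\infty$, regarded as a set of vertices. **Theorem 1.1.** The measure $\mathbb P_\infty$ exists, and the IIC stochastically dominates the IPC: there is a coupling of $C_\infty$ and $C$, that is, a probability measure on pairs of sets of vertices of $\mathcal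 T_\sigma$ whose two marginals are the law of $C$ and the law of $C_\infty$, under which $C\subset C_\infty$ with probability $1$. -/

import Mathlib

open MeasureTheory ProbabilityTheory Filter Topology

namespace RegularTree

/-- The vertices of the rooted regular tree with forward degree `σ`: the root is `[]`, and the
children of `v` are `i :: v` for `i : Fin σ`. The height of `v` is `v.length`. -/
abbrev Vertex (σ : ℕ) : Type := List (Fin σ)

/-- The edges of the tree: the pair `(v, i)` is the edge that joins `v` to its child `i :: v`. -/
abbrev Edge (σ : ℕ) : Type := Vertex σ × Fin σ

/-- The graph on the vertices of the tree whose edges are the edges in `ω` (the open edges).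
The tree itself is `openGraph Set.univ`. -/
def openGraph {σ : ℕ} (ω : Set (Edge σ)) : SimpleGraph (Vertex σ) :=
  SimpleGraph.fromRel fun u v => ∃ i : Fin σ, v = i :: u ∧ (u, i) ∈ ω

/-- The open cluster of the root. -/
def cluster {σ : ℕ} (ω : Set (Edge σ)) : Set (Vertex σ) :=
  {v | (openGraph ω).Reachable [] v}

/-! ### Invasion percolation -/

/-- The uniform distribution on `(0, 1)`. -/
noncomputable def uniform01 : Measure ℝ := volume.restrict (Set.Ioo 0 1)

instance : IsProbabilityMeasure uniform01 := ⟨by simp [uniform01]⟩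

/-- The law of i.i.d. edge weights that are uniform on `(0, 1)`. -/
noncomputable def weightLaw (σ : ℕ) : Measure (Edge σ → ℝ) :=
  Measure.infinitePi fun _ => uniform01

/-- The edges with exactly one endpoint in `S`. -/
def edgeBoundary {σ : ℕ} (S : Set (Vertex σ)) : Set (Edge σ) :=
  {e | Xor (e.1 ∈ S) ((e.2 :: e.1) ∈ S)}

/-- The set of vertices `I_N` invaded after `N` steps: start with the root, and in each step adjoin
the edge of smallest weight in the boundary (should several boundary edges share the smallest
weight, which has probability zero for i.i.d. uniform weights, they are all adjoined). The subtree
`I_N` contains every edge of the tree between two of its vertices, so that it is determined by its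
set of vertices. -/
def invaded {σ : ℕ} (w : Edge σ → ℝ) : ℕ → Set (Vertex σ)
  | 0 => {[]}
  | N + 1 => invaded w N ∪
      {v | ∃ e ∈ edgeBoundary (invaded w N),
        (∀ f ∈ edgeBoundary (invaded w N), w e ≤ w f) ∧ (v = e.1 ∨ v = e.2 :: e.1)}

/-- The invasion percolation cluster `C` for the weights `w`, as a set of vertices. -/
def ipc {σ : ℕ} (w : Edge σ → ℝ) : Set (Vertex σ) := ⋃ N, invaded w N

/-- The law of the invasion percolation cluster. -/
noncomputable def ipcLaw (σ : ℕ) : Measure (Set (Vertex σ)) := (weightLaw σ).map ipc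

/-! ### The incipient infinite cluster -/

/-- The critical value `1 / σ` of bond percolation on the tree. -/
noncomputable def pc (σ : ℕ) : unitInterval :=
  ⟨1 / (σ : ℝ), by positivity, by simpa using Nat.cast_inv_le_one σ⟩

/-- Independent bond percolation on the tree with parameter `p`, as the law of the random set of
open edges. -/
noncomputable def percolation (σ : ℕ) (p : unitInterval) : Measure (Set (Edge σ)) :=
  setBernoulli Set.univ p

/-- The event `{o → n}` that the root is connected to a vertex at height `n`. -/
def connectedTo (σ n : ℕ) : Set (Set (Edge σ)) := {ω | ∃ v ∈ cluster ω, v.length = n}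

/-- `E` is a cylinder event: it depends on the status of only finitely many edges. -/
def IsCylinder {σ : ℕ} (E : Set (Set (Edge σ))) : Prop :=
  ∃ F : Finset (Edge σ), ∀ ω ω' : Set (Edge σ),
    (∀ e ∈ F, e ∈ ω ↔ e ∈ ω') → (ω ∈ E ↔ ω' ∈ E)

/-- `ν` is the IIC measure `ℙ_∞`: the probability measure on bond configurations with
`ν E = lim ℙ_{p_c}(E | o → n)` for every cylinder event `E`. -/
structure IsIICMeasure (σ : ℕ) (ν : Measure (Set (Edge σ))) : Prop where
  isProbabilityMeasure : IsProbabilityMeasure ν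
  tendsto_cond : ∀ E : Set (Set (Edge σ)), IsCylinder E →
    Tendsto (fun n : ℕ => ProbabilityTheory.cond (percolation σ (pc σ)) (connectedTo σ n) E)
      atTop (𝓝 (ν E))

/-- The law of the cluster of the root under the measure `ν` on bond configurations. If `ν` is the
IIC measure, this is the law of the IIC `C_∞`. -/
noncomputable def clusterLaw {σ : ℕ} (ν : Measure (Set (Edge σ))) : Measure (Set (Vertex σ)) :=
  ν.map cluster

/-- `γ` is a coupling of `μ` and `ν`: a probability measure with these two marginals. -/
structure IsCoupling {α β : Type*} [MeasurableSpace α] [MeasurableSpace β]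
    (γ : Measure (α × β)) (μ : Measure α) (ν : Measure β) : Prop where
  isProbabilityMeasure : IsProbabilityMeasure γ
  fst_eq : γ.map Prod.fst = μ
  snd_eq : γ.map Prod.snd = ν

end RegularTree

/-! The IIC has an explicit description: open all edges of a uniform random ray from the root, and
let every other edge be open independently with probability `1 / σ`. To see that this is the limit,
fix the configuration `A` below height `h`, and let `Z` be the number of vertices of height `h` in
its root cluster. The subtrees above are independent copies of the whole tree, so `A` together with
`o → m + h` has probability `P(A) (1 - (1 - θ_m)^Z)`, where θ_m = `oneArm σ m`. As θ_m tends to 0,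
conditioning reweights `P(A)` by `Z`. The ray produces the same weight: it uses one of the `Z`
vertices, and its probability `σ^(-h)` is exactly that of `h` critical edges being open
(`iicMeasure_agree`, `isIICMeasure_iicMeasure`). Cylinder events determine the measure, so this
description applies to every IIC measure.

For the domination, fix a height `n`. Almost surely one vertex `v` of height `n` has the minimax
path: beyond each branch point its largest weight is smaller than that of every competitor. A branch
that leaves this path at height `k` is explored up to the level `M_k`, the largest path weight from
height `k` on. These explored branches and the path form a finite tree `S`, which contains `invaded
w n` and has `v` as its only vertex of height `n`. Given the path weights, the branches are
percolation with parameters `M_k`, restricted to not reaching height `n`.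

By duality, percolation that is conditioned not to reach a given height is again independent
percolation, with edge probabilities that depend on the remaining height. These probabilities are at
most `1 / σ` (`dualRate_le`). The restriction costs a factor that depends only on the path weights,
not on `v` or `S` (`prod_offEdges_eq`). Hence `(v, S)` has the law of a uniform path, path weights
with a changed density, and independent dual branches (`weightLaw_treeEvent_eq_spineLaw`). If those
branches are realised with the weights that define critical percolation, `S` lies inside the IIC.
Matching the events of equal probability couples `invaded w n` with the IIC, and compactness gives
the limit in `n`. -/

namespace RegularTree

/-! ### The cluster of the root -/

section Cluster

variable {σ : ℕ}

lemma openGraph_adj {ω : Set (Edge σ)} {u v : Vertex σ} :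
    (openGraph ω).Adj u v ↔
      (∃ i, v = i :: u ∧ (u, i) ∈ ω) ∨ (∃ i, u = i :: v ∧ (v, i) ∈ ω) := by
  simp only [openGraph, SimpleGraph.fromRel_adj, and_iff_right_iff_imp]
  rintro (⟨i, rfl, -⟩ | ⟨i, rfl, -⟩) h
  · simpa using congrArg List.length h
  · simpa using congrArg List.length h

/-- All edges on the path from the root to the vertex are open. -/
def OpenPath (ω : Set (Edge σ)) : Vertex σ → Prop
  | [] => True
  | i :: u => OpenPath ω u ∧ (u, i) ∈ ω

lemma mem_cluster_iff_openPath {ω : Set (Edge σ)} {v : Vertex σ} :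
    v ∈ cluster ω ↔ OpenPath ω v := by
  constructor
  · rintro ⟨p⟩
    suffices ∀ a b : Vertex σ, (openGraph ω).Walk a b → OpenPath ω a → OpenPath ω b from
      this _ _ p trivial
    intro a b p
    induction p with
    | nil => exact id
    | cons h _ ih =>
      intro ha
      apply ih
      rcases openGraph_adj.1 h with ⟨i, rfl, hi⟩ | ⟨i, rfl, hi⟩
      · exact ⟨ha, hi⟩
      · exact ha.1
  · intro h
    induction v with
    | nil => exact SimpleGraph.Reachable.refl _
    | cons i u ih =>
      exact (ih h.1).trans (SimpleGraph.Adj.reachable (openGraph_adj.2 (.inl ⟨i, rfl, h.2⟩)))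

@[simp] lemma nil_mem_cluster (ω : Set (Edge σ)) : [] ∈ cluster ω :=
  mem_cluster_iff_openPath.2 trivial

lemma cons_mem_cluster {ω : Set (Edge σ)} {i : Fin σ} {u : Vertex σ} :
    i :: u ∈ cluster ω ↔ u ∈ cluster ω ∧ (u, i) ∈ ω := by
  simp [mem_cluster_iff_openPath, OpenPath]

/-- The embedding of the tree as the subtree of the descendants of `v`. -/
def shift (v : Vertex σ) (e : Edge σ) : Edge σ := (e.1 ++ v, e.2)

lemma append_mem_cluster {ω : Set (Edge σ)} {u v : Vertex σ} :
    u ++ v ∈ cluster ω ↔ v ∈ cluster ω ∧ u ∈ cluster (shift v ⁻¹' ω) := by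
  induction u with
  | nil => simp
  | cons i u ih => simp [cons_mem_cluster, ih, shift, and_assoc]

lemma mem_cluster_iff_forall_suffix {ω : Set (Edge σ)} {v : Vertex σ} :
    v ∈ cluster ω ↔ ∀ i u, i :: u <:+ v → (u, i) ∈ ω := by
  induction v with
  | nil => simp
  | cons j v ih =>
    rw [cons_mem_cluster, ih]
    constructor
    · rintro ⟨h, hj⟩ i u hu
      rcases List.suffix_cons_iff.1 hu with h' | h'
      · obtain ⟨rfl, rfl⟩ := List.cons.inj h'
        exact hj
      · exact h i u h'
    · exact fun h => ⟨fun i u hu => h i u (hu.trans (List.suffix_cons j v)),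
        h j v (List.suffix_refl _)⟩

lemma measurable_cluster : Measurable (cluster : Set (Edge σ) → Set (Vertex σ)) := by
  refine measurable_set_iff.2 fun v => ?_
  induction v with
  | nil => simp
  | cons i u ih =>
    simp only [cons_mem_cluster]
    exact ih.and (measurable_set_mem _)

end Cluster

/-! ### Weights and percolation -/

lemma uniform01_Iic {t : ℝ} (h0 : 0 ≤ t) (h1 : t ≤ 1) :
    uniform01 (Set.Iic t) = ENNReal.ofReal t := by
  rw [uniform01, Measure.restrict_apply measurableSet_Iic]
  rcases h1.lt_or_eq with h | rfl
  · have : Set.Iic t ∩ Set.Ioo 0 1 = Set.Ioc 0 t := by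
      ext x; simp; grind
    simp [this]
  · have : Set.Iic (1 : ℝ) ∩ Set.Ioo 0 1 = Set.Ioo 0 1 := by
      ext x; simp; grind
    simp [this]

lemma uniform01_Ioi {t : ℝ} (h0 : 0 ≤ t) (h1 : t ≤ 1) :
    uniform01 (Set.Ioi t) = ENNReal.ofReal (1 - t) := by
  rw [← Set.compl_Iic, prob_compl_eq_one_sub measurableSet_Iic, uniform01_Iic h0 h1,
    ENNReal.ofReal_sub _ h0, ENNReal.ofReal_one]

lemma ae_uniform01 : ∀ᵐ x ∂uniform01, x ∈ Set.Ioo (0 : ℝ) 1 :=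
  ae_restrict_mem measurableSet_Ioo

instance : NullSingletonClass uniform01 := by unfold uniform01; infer_instance

section

variable {σ : ℕ}

instance : IsProbabilityMeasure (weightLaw σ) := by unfold weightLaw; infer_instance

lemma ae_infinitePi_uniform01 {ι : Type*} [Countable ι] :
    ∀ᵐ w ∂(Measure.infinitePi fun _ : ι => uniform01), ∀ e, w e ∈ Set.Ioo (0 : ℝ) 1 := by
  refine ae_all_iff.2 fun e => ?_
  have := ae_uniform01
  rw [← Measure.infinitePi_map_eval (fun _ : ι => uniform01) e] at this
  exact ae_of_ae_map (f := fun w : ι → ℝ => w e) (measurable_pi_apply e).aemeasurable this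

lemma ae_injective_weightLaw : ∀ᵐ w ∂weightLaw σ, Function.Injective w := by
  have : ∀ᵐ w ∂weightLaw σ, ∀ e f : Edge σ, e ≠ f → w e ≠ w f := by
    simp only [ae_all_iff]
    intro e f hef
    have key : ∀ᵐ x ∂(uniform01.prod uniform01), x.1 ≠ x.2 := by
      rw [Measure.ae_prod_iff_ae_ae]
      · refine ae_of_all _ fun x => ?_
        filter_upwards [compl_mem_ae_iff.2 (measure_singleton (μ := uniform01) x)] with y hy h
        exact hy (by simp [← h])
      · exact (measurableSet_eq_fun measurable_fst measurable_snd).compl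
    rw [← Measure.infinitePi_map_eval_prod (P := fun _ : Edge σ => uniform01) hef] at key
    exact ae_of_ae_map (f := fun w : Edge σ → ℝ => (w e, w f))
      ((measurable_pi_apply e).prodMk (measurable_pi_apply f)).aemeasurable key
  filter_upwards [this] with w hw e f h
  by_contra hef
  exact hw e f hef h

/-- The set of edges with weight at most `1 / σ`. -/
def openEdges (w : Edge σ → ℝ) : Set (Edge σ) := {e | w e ≤ 1 / σ}

lemma measurable_openEdges : Measurable (openEdges : (Edge σ → ℝ) → Set (Edge σ)) := by
  refine measurable_set_iff.2 fun e => ?_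
  simp only [openEdges, Set.mem_ofPred_eq]
  exact measurableSet_setOfPred.1 (measurableSet_le (measurable_pi_apply e) measurable_const)

/-- Thresholding a uniform weight at `1 / σ` gives a Bernoulli variable, and coordinatewise maps
commute with product measures. Percolation can thus be compared with other thresholds on the same
weights. -/
lemma percolation_eq_map : percolation σ (pc σ) = (weightLaw σ).map openEdges := by
  have h0 : (0 : ℝ) ≤ 1 / σ := by positivity
  have h1 : (1 / σ : ℝ) ≤ 1 := (pc σ).2.2
  have hm : Measurable fun x : ℝ => x ≤ 1 / σ :=
    measurableSet_setOfPred.1 (measurableSet_le measurable_id measurable_const)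
  have huni : uniform01.map (fun x : ℝ => x ≤ 1 / σ)
      = unitInterval.toNNReal (pc σ) • Measure.dirac True
        + unitInterval.toNNReal (unitInterval.symm (pc σ)) • Measure.dirac False := by
    refine Measure.ext_of_singleton fun p => ?_
    rw [Measure.map_apply hm (MeasurableSet.of_discrete)]
    by_cases hp : p
    · have : (fun x : ℝ => x ≤ 1 / σ) ⁻¹' {p} = Set.Iic (1 / σ : ℝ) := by ext; simp [hp]
      rw [this, uniform01_Iic h0 h1, eq_true hp, Measure.add_apply, Measure.smul_apply,
        Measure.smul_apply, Measure.dirac_apply_of_mem (Set.mem_singleton _), Measure.dirac_apply' _ (by trivial)]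
      simp only [Set.mem_singleton_iff, false_ne_true, not_false_eq_true, Set.indicator_of_notMem,
        smul_zero, add_zero, ENNReal.smul_def, smul_eq_mul, mul_one]
      exact ENNReal.ofReal_coe_nnreal (p := unitInterval.toNNReal (pc σ))
    · have : (fun x : ℝ => x ≤ 1 / σ) ⁻¹' {p} = Set.Ioi (1 / σ : ℝ) := by ext; simp [hp]
      rw [this, uniform01_Ioi h0 h1, eq_false hp, Measure.add_apply, Measure.smul_apply,
        Measure.smul_apply, Measure.dirac_apply_of_mem (Set.mem_singleton _), Measure.dirac_apply' _ (by trivial)]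
      simp only [Set.mem_singleton_iff, true_ne_false, not_false_eq_true, Set.indicator_of_notMem,
        smul_zero, zero_add, ENNReal.smul_def, smul_eq_mul, mul_one]
      exact ENNReal.ofReal_coe_nnreal (p := unitInterval.toNNReal (unitInterval.symm (pc σ)))
  rw [percolation, setBernoulli_eq_map]
  simp only [Set.mem_univ]
  rw [← huni, ← Measure.infinitePi_map_pi _ (fun _ => hm), Measure.map_map (by fun_prop) (by fun_prop)]
  rfl

end

/-! ### Finite product computations -/

section Product

lemma infinitePi_prod_map_sumElim {ι κ X : Type*} [MeasurableSpace X] (m : Measure X)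
    [IsProbabilityMeasure m] :
    ((Measure.infinitePi fun _ : ι => m).prod (Measure.infinitePi fun _ : κ => m)).map
      (fun p => (Sum.elim p.1 p.2 : ι ⊕ κ → X)) = Measure.infinitePi fun _ => m := by
  have hmeas : Measurable fun p : (ι → X) × (κ → X) => (Sum.elim p.1 p.2 : ι ⊕ κ → X) := by
    refine measurable_pi_iff.2 fun a => ?_
    rcases a with a | a
    · exact (measurable_pi_apply a).comp measurable_fst
    · exact (measurable_pi_apply a).comp measurable_snd
  refine Measure.eq_infinitePi _ fun s t ht => ?_
  rw [Measure.map_apply hmeas (.pi s.countable_toSet fun i _ => ht i)]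
  have : (fun p : (ι → X) × (κ → X) => (Sum.elim p.1 p.2 : ι ⊕ κ → X)) ⁻¹' (Set.pi s t)
      = (Set.pi (s.toLeft : Set ι) fun i => t (.inl i)) ×ˢ
        (Set.pi (s.toRight : Set κ) fun i => t (.inr i)) := by
    ext p
    simp [Set.mem_pi]
  rw [this, Measure.prod_prod, Measure.infinitePi_pi _ (fun i _ => ht _),
    Measure.infinitePi_pi _ (fun i _ => ht _)]
  conv_rhs => rw [← Finset.toLeft_disjSum_toRight (u := s), Finset.prod_disjSum]

lemma infinitePi_sum_map_prodMk {ι κ X : Type*} [MeasurableSpace X] (m : Measure X)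
    [IsProbabilityMeasure m] :
    (Measure.infinitePi fun _ : ι ⊕ κ => m).map (fun x => (fun i => x (.inl i), fun k => x (.inr k)))
      = (Measure.infinitePi fun _ : ι => m).prod (Measure.infinitePi fun _ : κ => m) := by
  have hmeas : Measurable fun p : (ι → X) × (κ → X) => (Sum.elim p.1 p.2 : ι ⊕ κ → X) := by
    refine measurable_pi_iff.2 fun a => ?_
    rcases a with a | a
    · exact (measurable_pi_apply a).comp measurable_fst
    · exact (measurable_pi_apply a).comp measurable_snd
  rw [← infinitePi_prod_map_sumElim, Measure.map_map (by fun_prop) hmeas]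
  exact Measure.map_id

variable {σ : ℕ}

lemma measurableSet_box (F : Finset (Edge σ)) (t : Edge σ → ℝ) (q : Edge σ → Prop) :
    MeasurableSet {w : Edge σ → ℝ | ∀ e ∈ F, w e ≤ t e ↔ q e} := by
  refine measurableSet_setOfPred.2 (Measurable.forall fun e => Measurable.imp measurable_const ?_)
  exact Measurable.iff
    (measurableSet_setOfPred.1 (measurableSet_le (measurable_pi_apply e) measurable_const))
    measurable_const

open scoped Classical in
lemma weightLaw_box (F : Finset (Edge σ)) {t : Edge σ → ℝ} (q : Edge σ → Prop)
    (h0 : ∀ e ∈ F, 0 ≤ t e) (h1 : ∀ e ∈ F, t e ≤ 1) :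
    weightLaw σ {w | ∀ e ∈ F, w e ≤ t e ↔ q e}
      = ENNReal.ofReal (∏ e ∈ F, if q e then t e else 1 - t e) := by
  have : {w : Edge σ → ℝ | ∀ e ∈ F, w e ≤ t e ↔ q e}
      = Set.pi F fun e => if q e then Set.Iic (t e) else Set.Ioi (t e) := by
    ext w
    simp only [Set.mem_ofPred_eq, Set.mem_pi, Finset.mem_coe]
    refine forall₂_congr fun e _ => ?_
    split_ifs with h <;> simp [h]
  rw [this, weightLaw, Measure.infinitePi_pi, ENNReal.ofReal_prod_of_nonneg]
  · refine Finset.prod_congr rfl fun e he => ?_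
    split_ifs
    · exact uniform01_Iic (h0 e he) (h1 e he)
    · exact uniform01_Ioi (h0 e he) (h1 e he)
  · intro e he
    split_ifs
    · exact h0 e he
    · linarith [h1 e he]
  · intro e _
    split_ifs
    · exact measurableSet_Iic
    · exact measurableSet_Ioi

end Product

/-! ### Edges and vertices of bounded height -/

section Height

variable {σ : ℕ}

variable (σ) in
/-- The edges whose upper endpoint has height less than `h`. -/
noncomputable def edgesBelow (h : ℕ) : Finset (Edge σ) :=
  (List.finite_length_lt (Fin σ) h).toFinset ×ˢ Finset.univ

variable (σ) in
/-- The vertices of height `h`. -/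
noncomputable def level (h : ℕ) : Finset (Vertex σ) := (List.finite_length_eq (Fin σ) h).toFinset

@[simp] lemma mem_edgesBelow {h : ℕ} {e : Edge σ} : e ∈ edgesBelow σ h ↔ e.1.length < h := by
  simp [edgesBelow]

@[simp] lemma mem_level {h : ℕ} {v : Vertex σ} : v ∈ level σ h ↔ v.length = h := by
  simp [level]

/-- The edges on the path from the root to a vertex. -/
def spineEdges : Vertex σ → Finset (Edge σ)
  | [] => ∅
  | i :: u => insert (u, i) (spineEdges u)

lemma mem_spineEdges {v : Vertex σ} {e : Edge σ} : e ∈ spineEdges v ↔ e.2 :: e.1 <:+ v := by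
  induction v with
  | nil => simp [spineEdges]
  | cons i u ih =>
    rw [spineEdges, Finset.mem_insert, ih, List.suffix_cons_iff]
    refine or_congr_left ?_
    rw [Prod.ext_iff]
    simp [and_comm]

lemma card_spineEdges (v : Vertex σ) : (spineEdges v).card = v.length := by
  induction v with
  | nil => rfl
  | cons i u ih =>
    rw [spineEdges, Finset.card_insert_of_notMem, ih, List.length_cons]
    rw [mem_spineEdges]
    intro h
    simpa using h.length_le

lemma spineEdges_subset_edgesBelow {v : Vertex σ} : spineEdges v ⊆ edgesBelow σ v.length := by
  intro e he
  have := (mem_spineEdges.1 he).length_le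
  simp at this ⊢
  omega

lemma mem_cluster_iff_spineEdges_subset {ω : Set (Edge σ)} {v : Vertex σ} :
    v ∈ cluster ω ↔ (spineEdges v : Set (Edge σ)) ⊆ ω := by
  rw [mem_cluster_iff_forall_suffix]
  constructor
  · intro h e he
    exact h e.2 e.1 (mem_spineEdges.1 he)
  · intro h i u hu
    exact h (mem_spineEdges.2 hu)

/-- The configurations that agree with `A` on the edges below height `h`. -/
def agree (h : ℕ) (A : Set (Edge σ)) : Set (Set (Edge σ)) :=
  {ω | ∀ e ∈ edgesBelow σ h, e ∈ ω ↔ e ∈ A}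

lemma measurableSet_agree (h : ℕ) (A : Set (Edge σ)) : MeasurableSet (agree h A) :=
  measurableSet_setOfPred.2 (Measurable.forall fun e => Measurable.imp measurable_const
    (Measurable.iff (measurable_set_mem e) measurable_const))

lemma mem_cluster_congr {h : ℕ} {ω A : Set (Edge σ)} (hω : ω ∈ agree h A) {v : Vertex σ}
    (hv : v.length ≤ h) : v ∈ cluster ω ↔ v ∈ cluster A := by
  rw [mem_cluster_iff_spineEdges_subset, mem_cluster_iff_spineEdges_subset]
  refine forall₂_congr fun e he => hω e ?_
  have := spineEdges_subset_edgesBelow he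
  simp at this ⊢
  omega

open scoped Classical in
lemma eq_biUnion_agree {h : ℕ} {E : Set (Set (Edge σ))}
    (hE : ∀ ω ω' : Set (Edge σ), (∀ e ∈ edgesBelow σ h, e ∈ ω ↔ e ∈ ω') → (ω ∈ E ↔ ω' ∈ E)) :
    E = ⋃ A ∈ (edgesBelow σ h).powerset.filter (fun A : Finset (Edge σ) => (A : Set (Edge σ)) ∈ E),
      agree h (A : Set (Edge σ)) := by
  ext ω
  simp only [Set.mem_iUnion, Finset.mem_filter, Finset.mem_powerset, exists_prop]
  constructor
  · intro hω
    have hag : ∀ e ∈ edgesBelow σ h, e ∈ ω ↔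
        e ∈ (((edgesBelow σ h).filter (· ∈ ω) : Finset (Edge σ)) : Set (Edge σ)) := by
      intro e he
      have he' : e.1.length < h := mem_edgesBelow.1 he
      simp [he']
    exact ⟨_, ⟨Finset.filter_subset _ _, (hE _ _ hag).1 hω⟩, hag⟩
  · rintro ⟨A, ⟨-, hA⟩, hω⟩
    exact (hE _ _ hω).2 hA

lemma measurableSet_of_isCylinder {E : Set (Set (Edge σ))} (hE : IsCylinder E) :
    ∃ h, (∀ ω ω' : Set (Edge σ), (∀ e ∈ edgesBelow σ h, e ∈ ω ↔ e ∈ ω') → (ω ∈ E ↔ ω' ∈ E)) ∧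
      MeasurableSet E := by
  classical
  obtain ⟨F, hF⟩ := hE
  have hsub : F ⊆ edgesBelow σ (F.sup (fun e => e.1.length) + 1) := by
    intro e he
    rw [mem_edgesBelow, Nat.lt_succ_iff]
    exact Finset.le_sup (f := fun e : Edge σ => e.1.length) he
  refine ⟨_, fun ω ω' h => hF ω ω' fun e he => h e (hsub he), ?_⟩
  rw [eq_biUnion_agree (E := E) fun ω ω' h => hF ω ω' fun e he => h e (hsub he)]
  exact Finset.measurableSet_biUnion _ fun A _ => measurableSet_agree _ _

lemma pairwiseDisjoint_agree (h : ℕ) :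
    ((edgesBelow σ h).powerset : Set (Finset (Edge σ))).PairwiseDisjoint
      fun A => agree h (A : Set (Edge σ)) := by
  intro A hA B hB hAB
  refine Set.disjoint_left.2 fun ω h1 h2 => hAB ?_
  rw [Finset.mem_coe, Finset.mem_powerset] at hA hB
  ext e
  constructor
  · exact fun he => (h2 e (hA he)).1 ((h1 e (hA he)).2 he)
  · exact fun he => (h1 e (hB he)).1 ((h2 e (hB he)).2 he)

open scoped Classical in
lemma measureReal_eq_sum_agree {h : ℕ} {E : Set (Set (Edge σ))}
    (hE : ∀ ω ω' : Set (Edge σ), (∀ e ∈ edgesBelow σ h, e ∈ ω ↔ e ∈ ω') → (ω ∈ E ↔ ω' ∈ E))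
    (μ : Measure (Set (Edge σ))) [IsFiniteMeasure μ] :
    μ.real E = ∑ A ∈ (edgesBelow σ h).powerset.filter
      (fun A : Finset (Edge σ) => (A : Set (Edge σ)) ∈ E), μ.real (agree h (A : Set (Edge σ))) := by
  conv_lhs => rw [eq_biUnion_agree hE]
  refine measureReal_biUnion_finset ((pairwiseDisjoint_agree h).subset ?_)
    (fun A _ => measurableSet_agree _ _)
  exact_mod_cast Finset.filter_subset _ _

lemma sum_measureReal_agree (h : ℕ) (μ : Measure (Set (Edge σ))) [IsProbabilityMeasure μ] :
    ∑ A ∈ (edgesBelow σ h).powerset, μ.real (agree h (A : Set (Edge σ))) = 1 := by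
  have := measureReal_eq_sum_agree (h := h) (E := Set.univ) (by simp) μ
  simpa using this.symm

end Height

/-! ### Critical percolation given the configuration near the root -/

section Critical

variable {σ : ℕ}

/-- The probability that the root is connected to height `n` in critical percolation. -/
noncomputable def oneArm (σ n : ℕ) : ℝ := (percolation σ (pc σ)).real (connectedTo σ n)

instance : IsProbabilityMeasure (percolation σ (pc σ)) := by unfold percolation; infer_instance

open scoped Classical in
/-- The vertices of height `h` in the cluster of the root. -/
noncomputable def clusterLevel (h : ℕ) (A : Set (Edge σ)) : Finset (Vertex σ) :=
  (level σ h).filter (· ∈ cluster A)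

lemma measurableSet_connectedTo (n : ℕ) : MeasurableSet (connectedTo σ n) := by
  refine measurableSet_setOfPred.2 (Measurable.exists fun v => Measurable.and ?_ measurable_const)
  exact (measurable_set_mem v).comp measurable_cluster

lemma measurable_shift_preimage (v : Vertex σ) :
    Measurable fun ω : Set (Edge σ) => shift v ⁻¹' ω :=
  measurable_set_iff.2 fun e => measurable_set_mem (shift v e)

lemma mem_connectedTo_add {ω : Set (Edge σ)} {h m : ℕ} {A : Set (Edge σ)} (hω : ω ∈ agree h A) :
    ω ∈ connectedTo σ (m + h) ↔ ∃ v ∈ clusterLevel h A, shift v ⁻¹' ω ∈ connectedTo σ m := by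
  simp only [connectedTo, Set.mem_ofPred_eq, clusterLevel, Finset.mem_filter, mem_level]
  constructor
  · rintro ⟨x, hx, hxl⟩
    have hsplit := List.take_append_drop m x
    have hd : (x.drop m).length = h := by simp [hxl]
    rw [← hsplit, append_mem_cluster] at hx
    exact ⟨x.drop m, ⟨hd, (mem_cluster_congr hω hd.le).1 hx.1⟩, x.take m, hx.2, by simp [hxl]⟩
  · rintro ⟨v, ⟨hvl, hv⟩, u, hu, hul⟩
    exact ⟨u ++ v, append_mem_cluster.2 ⟨(mem_cluster_congr hω hvl.le).2 hv, hu⟩, by simp [hul, hvl]⟩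

/-- The embedding of the edges below height `h` and of the subtrees at height `h` in the tree. -/
def blockEmb (h : ℕ) : (edgesBelow σ h) ⊕ (level σ h × Edge σ) → Edge σ :=
  Sum.elim (fun e => e) (fun p => shift p.1 p.2)

lemma blockEmb_injective (h : ℕ) : Function.Injective (blockEmb (σ := σ) h) := by
  refine Function.Injective.sumElim Subtype.val_injective ?_ ?_
  · rintro ⟨⟨v, hv⟩, u, i⟩ ⟨⟨v', hv'⟩, u', i'⟩ heq
    simp only [shift, Prod.mk.injEq] at heq
    rw [mem_level] at hv hv'
    obtain ⟨h1, h2⟩ := List.append_inj' heq.1 (hv.trans hv'.symm)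
    simp [h1, h2, heq.2]
  · rintro ⟨e, he⟩ ⟨⟨v, hv⟩, u, i⟩ heq
    rw [mem_edgesBelow] at he
    rw [mem_level] at hv
    simp only [shift] at heq
    rw [heq] at he
    simp at he
    omega

/-- The branching property: an injective reindexing of an i.i.d. family is i.i.d., and `blockEmb`
splits off the edges below height `h` and one copy of the whole tree at each vertex of height `h`.
-/
lemma weightLaw_map_block (h : ℕ) :
    (weightLaw σ).map (fun w => ((fun e => w e : edgesBelow σ h → ℝ),
        (fun v e => w (shift v e) : level σ h → Edge σ → ℝ)))
      = (Measure.infinitePi fun _ : edgesBelow σ h => uniform01).prod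
          (Measure.infinitePi fun _ : level σ h => weightLaw σ) := by
  have h1 := Measure.map_infinitePi_infinitePi_of_inj (P := fun _ : Edge σ => uniform01)
    (blockEmb_injective (σ := σ) h)
  have h2 := infinitePi_sum_map_prodMk (ι := edgesBelow σ h) (κ := level σ h × Edge σ) uniform01
  have h3 := Measure.infinitePi_map_curry (ι := level σ h) (κ := Edge σ) (X := ℝ)
    (fun _ _ => uniform01)
  have hc : Measurable (Function.curry : (level σ h × Edge σ → ℝ) → level σ h → Edge σ → ℝ) :=
    measurable_pi_iff.2 fun v => measurable_pi_iff.2 fun e => measurable_pi_apply (v, e)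
  have h4 : Measure.map (Prod.map id Function.curry)
        ((Measure.infinitePi fun _ : edgesBelow σ h => uniform01).prod
          (Measure.infinitePi fun _ : level σ h × Edge σ => uniform01))
      = (Measure.infinitePi fun _ : edgesBelow σ h => uniform01).prod
          (Measure.infinitePi fun _ : level σ h => weightLaw σ) := by
    rw [← Measure.map_prod_map _ _ measurable_id hc, Measure.map_id]
    congr 1
  rw [← h4, ← h2, ← h1, Measure.map_map (by fun_prop) (by fun_prop),
    Measure.map_map ((measurable_id.prodMap hc).comp (by fun_prop)) (by fun_prop)]
  rfl

lemma percolation_agree_inter_block (h m : ℕ) (A : Set (Edge σ)) (K : Finset (Vertex σ)) (hK : K ⊆ level σ h) :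
    (percolation σ (pc σ)).real
        (agree h A ∩ {ω | ∀ v ∈ K, shift v ⁻¹' ω ∉ connectedTo σ m})
      = (percolation σ (pc σ)).real (agree h A) * (1 - oneArm σ m) ^ K.card := by
  classical
  set a : Set (edgesBelow σ h → ℝ) := {x | ∀ e, x e ≤ 1 / σ ↔ (e : Edge σ) ∈ A} with ha
  have hma : MeasurableSet a :=
    measurableSet_setOfPred.2 (Measurable.forall fun e => Measurable.iff
      (measurableSet_setOfPred.1 (measurableSet_le (measurable_pi_apply e) measurable_const))
      measurable_const)
  have hmc : MeasurableSet {w : Edge σ → ℝ | openEdges w ∉ connectedTo σ m} :=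
    measurable_openEdges (measurableSet_connectedTo m).compl
  set b : Set (level σ h → Edge σ → ℝ) :=
    Set.pi (Finset.univ.filter fun v : level σ h => (v : Vertex σ) ∈ K)
      (fun _ => {w | openEdges w ∉ connectedTo σ m}) with hb
  have hmb : MeasurableSet b := .pi (Set.to_countable _) fun _ _ => hmc
  have hblock : Measurable (fun w : Edge σ → ℝ => ((fun e => w e : edgesBelow σ h → ℝ),
        (fun v e => w (shift v e) : level σ h → Edge σ → ℝ))) := by fun_prop
  have key : ∀ b', MeasurableSet b' → (weightLaw σ) ((fun w => ((fun e => w e : edgesBelow σ h → ℝ),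
        (fun v e => w (shift v e) : level σ h → Edge σ → ℝ))) ⁻¹' (a ×ˢ b'))
      = (Measure.infinitePi fun _ : edgesBelow σ h => uniform01) a *
          (Measure.infinitePi fun _ : level σ h => weightLaw σ) b' := by
    intro b' hb'
    rw [← Measure.map_apply hblock (hma.prod hb'), weightLaw_map_block, Measure.prod_prod]
  have hQ : (weightLaw σ).real {w | openEdges w ∉ connectedTo σ m} = 1 - oneArm σ m := by
    rw [oneArm, ← probReal_compl_eq_one_sub (measurableSet_connectedTo m), percolation_eq_map,
      map_measureReal_apply measurable_openEdges (measurableSet_connectedTo m).compl]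
    rfl
  have hB : (Measure.infinitePi fun _ : level σ h => weightLaw σ).real b
      = (1 - oneArm σ m) ^ K.card := by
    rw [hb, Measure.real, Measure.infinitePi_pi _ (fun _ _ => hmc), Finset.prod_const,
      ENNReal.toReal_pow, ← Measure.real, hQ]
    congr 1
    refine Finset.card_bij (fun v _ => v) (by simp) (by simp) fun v hv => ?_
    exact ⟨⟨v, hK hv⟩, by simpa using hv, rfl⟩
  have hset : MeasurableSet {ω : Set (Edge σ) | ∀ v ∈ K, shift v ⁻¹' ω ∉ connectedTo σ m} := by
    refine measurableSet_setOfPred.2 (Measurable.forall fun v => Measurable.imp measurable_const ?_)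
    exact measurableSet_setOfPred.1 (measurable_shift_preimage v (measurableSet_connectedTo m).compl)
  have e1 := congrArg ENNReal.toReal (key b hmb)
  -- With no condition on the subtrees, the product formula identifies the factor of `a` as the
  -- probability of `agree h A`.
  have e2 := congrArg ENNReal.toReal (key Set.univ .univ)
  rw [ENNReal.toReal_mul] at e1 e2
  rw [measure_univ, ENNReal.toReal_one, mul_one] at e2
  simp only [← Measure.real_def] at e1 e2
  rw [hB, ← e2] at e1
  rw [percolation_eq_map, map_measureReal_apply measurable_openEdges
    ((measurableSet_agree h A).inter hset), map_measureReal_apply measurable_openEdges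
    (measurableSet_agree h A)]
  have s1 : openEdges ⁻¹' (agree h A ∩ {ω | ∀ v ∈ K, shift v ⁻¹' ω ∉ connectedTo σ m})
      = (fun w : Edge σ → ℝ => ((fun e => w e : edgesBelow σ h → ℝ),
        (fun v e => w (shift v e) : level σ h → Edge σ → ℝ))) ⁻¹' (a ×ˢ b) := by
    ext w
    simp only [Set.mem_preimage, Set.mem_inter_iff, agree, Set.mem_ofPred_eq, ha, hb, Set.mem_prod,
      Set.mem_pi, Finset.coe_filter, Subtype.forall, openEdges, Finset.mem_univ, true_and]
    refine and_congr_right fun _ => ?_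
    exact ⟨fun H v _ hv => H v hv, fun H v hv => H v (hK hv) hv⟩
  have s2 : openEdges ⁻¹' agree h A
      = (fun w : Edge σ → ℝ => ((fun e => w e : edgesBelow σ h → ℝ),
        (fun v e => w (shift v e) : level σ h → Edge σ → ℝ))) ⁻¹' (a ×ˢ Set.univ) := by
    ext w
    simp [agree, ha, openEdges]
  rw [s1, s2, e1]

lemma oneArm_nonneg (m : ℕ) : 0 ≤ oneArm σ m := measureReal_nonneg

lemma oneArm_le_one (m : ℕ) : oneArm σ m ≤ 1 := measureReal_le_one

/-- The connection fails exactly when it fails above each of the `Z` cluster vertices of height `h`.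
Writing `1 - (1 - θ)^Z` as `θ` times a geometric sum isolates a factor that is continuous in `θ` and
equals `Z` at `θ = 0`. -/
lemma percolation_agree_inter_connectedTo (h m : ℕ) (A : Set (Edge σ)) :
    (percolation σ (pc σ)).real (connectedTo σ (m + h) ∩ agree h A)
      = oneArm σ m * ((percolation σ (pc σ)).real (agree h A) *
          ∑ j ∈ Finset.range (clusterLevel h A).card, (1 - oneArm σ m) ^ j) := by
  classical
  have h1 := percolation_agree_inter_block h m A (clusterLevel h A) (Finset.filter_subset _ _)
  have h2 : agree h A ∩ {ω | ∀ v ∈ clusterLevel h A, shift v ⁻¹' ω ∉ connectedTo σ m}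
      = agree h A \ connectedTo σ (m + h) := by
    ext ω
    refine and_congr_right fun hω => ?_
    rw [mem_connectedTo_add hω]
    simp
  rw [h2] at h1
  have h3 := measureReal_inter_add_sdiff (μ := percolation σ (pc σ)) (s := agree h A)
    (measurableSet_connectedTo (σ := σ) (m + h))
  have h4 := mul_neg_geom_sum (1 - oneArm σ m) (clusterLevel h A).card
  rw [Set.inter_comm] at h3
  rw [sub_sub_cancel] at h4
  rw [← mul_left_comm, h4]
  linarith

end Critical

/-! ### A ray with independent uniform steps -/

section Ray

variable {σ : ℕ}

/-- The vertex at height `n` on the ray with steps `b`. -/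
def rayVertex (b : ℕ → Fin σ) : ℕ → Vertex σ
  | 0 => []
  | n + 1 => b n :: rayVertex b n

@[simp] lemma length_rayVertex (b : ℕ → Fin σ) (n : ℕ) : (rayVertex b n).length = n := by
  induction n with
  | zero => rfl
  | succ n ih => simp [rayVertex, ih]

/-- The edges of the ray with steps `b`. -/
def rayEdges (b : ℕ → Fin σ) : Set (Edge σ) := {e | e.2 :: e.1 = rayVertex b (e.1.length + 1)}

lemma suffix_rayVertex_iff {b : ℕ → Fin σ} {n : ℕ} {u : Vertex σ} :
    u <:+ rayVertex b n ↔ u.length ≤ n ∧ u = rayVertex b u.length := by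
  induction n with
  | zero =>
    rw [rayVertex, List.suffix_nil, Nat.le_zero, List.length_eq_zero_iff]
    constructor
    · rintro rfl
      exact ⟨rfl, rfl⟩
    · exact And.left
  | succ n ih =>
    rw [rayVertex, List.suffix_cons_iff, ih]
    constructor
    · rintro (rfl | ⟨h1, h2⟩)
      · simp [rayVertex]
      · exact ⟨h1.trans n.le_succ, h2⟩
    · rintro ⟨h1, h2⟩
      rcases h1.lt_or_eq with h | h
      · exact .inr ⟨Nat.lt_succ_iff.1 h, h2⟩
      · rw [h] at h2
        exact .inl h2

lemma mem_rayEdges_iff {b : ℕ → Fin σ} {n : ℕ} {e : Edge σ} (he : e.1.length < n) :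
    e ∈ rayEdges b ↔ e ∈ spineEdges (rayVertex b n) := by
  rw [mem_spineEdges, suffix_rayVertex_iff]
  exact ⟨fun h => ⟨he, h⟩, And.right⟩

lemma exists_rayVertex_eq [NeZero σ] (v : Vertex σ) :
    ∃ c : ℕ → Fin σ, rayVertex c v.length = v := by
  induction v with
  | nil => exact ⟨fun _ => 0, rfl⟩
  | cons i u ih =>
    obtain ⟨c, hc⟩ := ih
    refine ⟨Function.update c u.length i, ?_⟩
    have : ∀ m ≤ u.length, rayVertex (Function.update c u.length i) m = rayVertex c m := by
      intro m hm
      induction m with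
      | zero => rfl
      | succ m ihm => rw [rayVertex, rayVertex, ihm (by omega), Function.update_of_ne (by omega)]
    rw [List.length_cons, rayVertex, this _ le_rfl, hc, Function.update_self]

lemma rayVertex_eq_iff {b c : ℕ → Fin σ} {n : ℕ} :
    rayVertex b n = rayVertex c n ↔ ∀ j < n, b j = c j := by
  induction n with
  | zero => simp [rayVertex]
  | succ n ih =>
    rw [rayVertex, rayVertex, List.cons.injEq, ih]
    constructor
    · rintro ⟨h1, h2⟩ j hj
      rcases Nat.lt_succ_iff_lt_or_eq.1 hj with h | rfl
      · exact h2 j h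
      · exact h1
    · exact fun h => ⟨h n (Nat.lt_succ_self n), fun j hj => h j (by omega)⟩

variable (σ) in
/-- The law of a sequence of independent uniform steps. -/
noncomputable def rayLaw : Measure (ℕ → Fin σ) :=
  Measure.infinitePi fun _ => uniformOn (Set.univ : Set (Fin σ))

instance [NeZero σ] : IsProbabilityMeasure (rayLaw σ) := by
  have : IsProbabilityMeasure (uniformOn (Set.univ : Set (Fin σ))) :=
    isProbabilityMeasure_uniformOn Set.finite_univ Set.univ_nonempty
  unfold rayLaw; infer_instance

lemma measurableSet_rayVertex_eq (n : ℕ) (v : Vertex σ) :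
    MeasurableSet {b : ℕ → Fin σ | rayVertex b n = v} := by
  induction n generalizing v with
  | zero => simp [rayVertex]
  | succ n ih =>
    cases v with
    | nil => simp [rayVertex]
    | cons i u =>
      simp only [rayVertex, List.cons.injEq]
      exact ((measurable_pi_apply n) (measurableSet_singleton i)).inter (ih u)

lemma rayLaw_rayVertex_eq [NeZero σ] (v : Vertex σ) :
    rayLaw σ {b | rayVertex b v.length = v} = ENNReal.ofReal ((1 / σ : ℝ) ^ v.length) := by
  have : IsProbabilityMeasure (uniformOn (Set.univ : Set (Fin σ))) :=
    isProbabilityMeasure_uniformOn Set.finite_univ Set.univ_nonempty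
  obtain ⟨c, hc⟩ := exists_rayVertex_eq v
  have : {b | rayVertex b v.length = v}
      = Set.pi (Finset.range v.length : Finset ℕ) fun j => {c j} := by
    ext b
    conv_lhs => rw [← hc]
    simp [rayVertex_eq_iff]
  have hu : ∀ i : Fin σ, uniformOn (Set.univ : Set (Fin σ)) {i} = ENNReal.ofReal (1 / σ : ℝ) := by
    intro i
    rw [uniformOn_univ]
    simp [ENNReal.ofReal_inv_of_pos (show (0 : ℝ) < σ from by exact_mod_cast NeZero.pos σ)]
  rw [this, rayLaw, Measure.infinitePi_pi _ (fun _ _ => measurableSet_singleton _)]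
  simp only [hu, Finset.prod_const, Finset.card_range]
  rw [ENNReal.ofReal_pow (by positivity)]

lemma measurable_rayEdges : Measurable (rayEdges : (ℕ → Fin σ) → Set (Edge σ)) := by
  refine measurable_set_iff.2 fun e => ?_
  have := measurableSet_setOfPred.1 (measurableSet_rayVertex_eq (e.1.length + 1) (e.2 :: e.1))
  simpa only [rayEdges, Set.mem_ofPred_eq, eq_comm] using this

end Ray

/-! ### The incipient infinite cluster measure -/

section IIC

variable {σ : ℕ}

/-- The edges that are on the ray or have weight at most `1 / σ`. -/
def iicConfig (p : (ℕ → Fin σ) × (Edge σ → ℝ)) : Set (Edge σ) := rayEdges p.1 ∪ openEdges p.2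

lemma measurable_iicConfig : Measurable (iicConfig (σ := σ)) := by
  refine measurable_set_iff.2 fun e => ?_
  simp only [iicConfig, Set.mem_union]
  exact (((measurable_set_mem e).comp measurable_rayEdges).comp measurable_fst).or
    (((measurable_set_mem e).comp measurable_openEdges).comp measurable_snd)

variable (σ) in
/-- The law of critical percolation to which an independent uniform ray has been added. -/
noncomputable def iicMeasure : Measure (Set (Edge σ)) :=
  ((rayLaw σ).prod (weightLaw σ)).map iicConfig

instance [NeZero σ] : IsProbabilityMeasure (iicMeasure σ) :=
  Measure.isProbabilityMeasure_map measurable_iicConfig.aemeasurable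

open scoped Classical in
lemma percolation_agree [NeZero σ] (h : ℕ) (A : Set (Edge σ)) :
    (percolation σ (pc σ)).real (agree h A)
      = ∏ e ∈ edgesBelow σ h, if e ∈ A then (1 / σ : ℝ) else 1 - 1 / σ := by
  have h1 : (1 / σ : ℝ) ≤ 1 := (pc σ).2.2
  rw [percolation_eq_map, map_measureReal_apply measurable_openEdges (measurableSet_agree _ _),
    Measure.real]
  have := weightLaw_box (edgesBelow σ h) (t := fun _ => 1 / σ) (fun e => e ∈ A)
    (fun _ _ => by positivity) (fun _ _ => h1)
  rw [show openEdges ⁻¹' agree h A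
    = {w : Edge σ → ℝ | ∀ e ∈ edgesBelow σ h, w e ≤ 1 / σ ↔ e ∈ A} from rfl,
    this, ENNReal.toReal_ofReal]
  refine Finset.prod_nonneg fun e _ => ?_
  split_ifs
  · positivity
  · linarith

/-- Split according to the ray's vertex of height `h`, which must be in the cluster of `A`. Each
such vertex contributes the same amount: the probability `σ^(-h)` of the ray replaces the factors `1
/ σ` of the `h` open edges on its path. -/
lemma iicMeasure_agree [NeZero σ] (h : ℕ) (A : Set (Edge σ)) :
    (iicMeasure σ).real (agree h A)
      = (percolation σ (pc σ)).real (agree h A) * (clusterLevel h A).card := by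
  classical
  have hσ : (0 : ℝ) < σ := by exact_mod_cast NeZero.pos σ
  have h1 : (1 / σ : ℝ) ≤ 1 := (pc σ).2.2
  set C : Vertex σ → Set (Edge σ → ℝ) := fun v =>
    {w | ∀ e ∈ edgesBelow σ h \ spineEdges v, w e ≤ 1 / σ ↔ e ∈ A} with hC
  have hpre : iicConfig ⁻¹' agree h A
      = ⋃ v ∈ clusterLevel h A, {b | rayVertex b h = v} ×ˢ C v := by
    ext ⟨b, w⟩
    simp only [Set.mem_preimage, Set.mem_iUnion, Set.mem_prod, exists_prop, clusterLevel,
      Finset.mem_filter, mem_level, agree, iicConfig, hC, Set.mem_ofPred_eq, Finset.mem_sdiff,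
      Set.mem_union, mem_edgesBelow]
    constructor
    · intro H
      refine ⟨rayVertex b h, ⟨length_rayVertex b h, mem_cluster_iff_spineEdges_subset.2 ?_⟩, rfl,
        fun e he => ?_⟩
      · intro e he
        have hlt : e.1.length < h := by simpa using spineEdges_subset_edgesBelow he
        exact (H e hlt).1 (.inl ((mem_rayEdges_iff hlt).2 he))
      · rw [← H e he.1, mem_rayEdges_iff he.1]
        exact ⟨.inr, fun h' => h'.resolve_left he.2⟩
    · rintro ⟨v, ⟨-, hv⟩, rfl, H⟩ e he
      rw [mem_rayEdges_iff he]
      by_cases hs : e ∈ spineEdges (rayVertex b h)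
      · simp [hs, mem_cluster_iff_spineEdges_subset.1 hv hs]
      · rw [or_iff_right hs]
        exact H e ⟨he, hs⟩
  have hmC : ∀ v, MeasurableSet (C v) := fun v => measurableSet_box _ (fun _ => 1 / σ) (· ∈ A)
  rw [iicMeasure, map_measureReal_apply measurable_iicConfig (measurableSet_agree _ _), hpre,
    measureReal_biUnion_finset]
  · rw [Finset.sum_congr rfl (g := fun _ => (percolation σ (pc σ)).real (agree h A)),
      Finset.sum_const, nsmul_eq_mul, mul_comm]
    intro v hv
    simp only [clusterLevel, Finset.mem_filter, mem_level] at hv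
    rw [measureReal_prod_prod, Measure.real, Measure.real, ← hv.1, rayLaw_rayVertex_eq,
      ENNReal.toReal_ofReal (by positivity), hC, weightLaw_box _ (· ∈ A) (fun _ _ => by positivity)
      (fun _ _ => h1), ENNReal.toReal_ofReal, percolation_agree, hv.1,
      ← Finset.prod_sdiff (s₁ := spineEdges v) (s₂ := edgesBelow σ h)
        (hv.1 ▸ spineEdges_subset_edgesBelow (v := v)), mul_comm]
    · congr 1
      rw [Finset.prod_congr rfl (g := fun _ => (1 / σ : ℝ)), Finset.prod_const, card_spineEdges, hv.1]
      intro e he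
      rw [if_pos (mem_cluster_iff_spineEdges_subset.1 hv.2 he)]
    · refine Finset.prod_nonneg fun e _ => ?_
      split_ifs
      · positivity
      · linarith
  · intro v _ v' _ hvv'
    refine Set.disjoint_left.2 fun p hp hp' => hvv' ?_
    exact hp.1.symm.trans hp'.1
  · exact fun v _ => (measurableSet_rayVertex_eq h v).prod (hmC v)

/-- Criticality: the mean number of cluster vertices at height `h` is 1, read off from the total
mass of `iicMeasure`. -/
lemma sum_percolation_agree_mul_card [NeZero σ] (h : ℕ) :
    ∑ A ∈ (edgesBelow σ h).powerset, (percolation σ (pc σ)).real (agree h (A : Set (Edge σ))) *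
      ((clusterLevel h (A : Set (Edge σ))).card : ℝ) = 1 := by
  rw [← sum_measureReal_agree h (iicMeasure σ)]
  exact Finset.sum_congr rfl fun A _ => (iicMeasure_agree h _).symm

lemma oneArm_pos [NeZero σ] (n : ℕ) : 0 < oneArm σ n := by
  classical
  have hσ : (0 : ℝ) < σ := by exact_mod_cast NeZero.pos σ
  have h1 : 0 < (percolation σ (pc σ)).real (agree n Set.univ) := by
    rw [percolation_agree]
    refine Finset.prod_pos fun e _ => ?_
    simp [hσ]
  refine h1.trans_le (measureReal_mono fun ω hω => ?_)
  refine ⟨List.replicate n 0, (mem_cluster_congr hω (by simp)).2 ?_, by simp⟩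
  exact mem_cluster_iff_spineEdges_subset.2 (Set.subset_univ _)

/-- The sum over the configurations below height `h` that gives the ratio of two connection
probabilities. -/
noncomputable def armRatio (σ h : ℕ) (x : ℝ) : ℝ :=
  ∑ A ∈ (edgesBelow σ h).powerset, (percolation σ (pc σ)).real (agree h (A : Set (Edge σ))) *
    ∑ j ∈ Finset.range (clusterLevel h (A : Set (Edge σ))).card, (1 - x) ^ j

lemma oneArm_add (h m : ℕ) : oneArm σ (m + h) = oneArm σ m * armRatio σ h (oneArm σ m) := by
  have := measureReal_eq_sum_agree (h := h) (E := Set.univ) (by simp)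
    ((percolation σ (pc σ)).restrict (connectedTo σ (m + h)))
  simp only [Set.mem_univ, Finset.filter_true] at this
  rw [measureReal_restrict_apply .univ, Set.univ_inter] at this
  rw [oneArm, this, armRatio, Finset.mul_sum]
  refine Finset.sum_congr rfl fun A _ => ?_
  rw [measureReal_restrict_apply (measurableSet_agree _ _), Set.inter_comm,
    percolation_agree_inter_connectedTo]

lemma continuous_armRatio (h : ℕ) : Continuous (armRatio σ h) := by
  unfold armRatio; fun_prop

lemma armRatio_zero [NeZero σ] (h : ℕ) : armRatio σ h 0 = 1 := by
  rw [← sum_percolation_agree_mul_card (σ := σ) h, armRatio]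
  simp

/-- A geometric sum of `Z` terms is at most `Z`, whose mean is 1. The inequality is strict when `Z ≥
2`, in particular when all `σ` edges at the root are open, which has positive probability. -/
lemma armRatio_one_lt_one (hσ : 2 ≤ σ) {x : ℝ} (h0 : 0 < x) (h1 : x ≤ 1) : armRatio σ 1 x < 1 := by
  classical
  have : NeZero σ := ⟨by omega⟩
  rw [← sum_percolation_agree_mul_card (σ := σ) 1, armRatio]
  have hle : ∀ k : ℕ, ∑ j ∈ Finset.range k, (1 - x) ^ j ≤ k := by
    intro k
    calc ∑ j ∈ Finset.range k, (1 - x) ^ j ≤ ∑ j ∈ Finset.range k, 1 :=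
          Finset.sum_le_sum fun j _ => pow_le_one₀ (by linarith) (by linarith)
      _ = k := by simp
  refine Finset.sum_lt_sum
    (fun A _ => mul_le_mul_of_nonneg_left (hle _) measureReal_nonneg)
    ⟨edgesBelow σ 1, Finset.mem_powerset_self _, mul_lt_mul_of_pos_left ?_ ?_⟩
  · have hc : (clusterLevel 1 (edgesBelow σ 1 : Set (Edge σ))).card = σ := by
      have : clusterLevel 1 (edgesBelow σ 1 : Set (Edge σ))
          = Finset.univ.image fun i : Fin σ => [i] := by
        ext v
        simp only [clusterLevel, Finset.mem_filter, mem_level, Finset.mem_image, Finset.mem_univ,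
          true_and]
        constructor
        · rintro ⟨h, -⟩
          obtain ⟨i, rfl⟩ := List.length_eq_one_iff.1 h
          exact ⟨i, rfl⟩
        · rintro ⟨i, rfl⟩
          exact ⟨rfl, by simp [cons_mem_cluster]⟩
      rw [this, Finset.card_image_of_injective _ (fun i j h => by simpa using h)]
      simp
    rw [hc]
    obtain ⟨k, rfl⟩ : ∃ k, σ = k + 1 + 1 := ⟨σ - 2, by omega⟩
    have h3 : ∑ j ∈ Finset.range k, (1 - x) ^ (j + 1 + 1) ≤ k := by
      calc ∑ j ∈ Finset.range k, (1 - x) ^ (j + 1 + 1) ≤ ∑ j ∈ Finset.range k, 1 :=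
            Finset.sum_le_sum fun j _ => pow_le_one₀ (by linarith) (by linarith)
        _ = k := by simp
    rw [Finset.sum_range_succ', Finset.sum_range_succ']
    push_cast
    simp only [pow_one, pow_zero]
    linarith
  · rw [percolation_agree]
    refine Finset.prod_pos fun e he => ?_
    have : (0 : ℝ) < σ := by positivity
    simp only [Finset.mem_coe, he, if_true]
    positivity

/-- There is no percolation at criticality: the sequence decreases, and its limit solves `L = L *
armRatio σ 1 L`, which has no solution in `(0, 1]`. -/
lemma tendsto_oneArm (hσ : 2 ≤ σ) : Tendsto (oneArm σ) atTop (𝓝 0) := by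
  have : NeZero σ := ⟨by omega⟩
  have hanti : Antitone (oneArm σ) := antitone_nat_of_succ_le fun n => by
    rw [oneArm_add 1 n]
    exact mul_le_of_le_one_right (oneArm_nonneg n)
      (armRatio_one_lt_one hσ (oneArm_pos n) (oneArm_le_one n)).le
  obtain ⟨L, hL⟩ : ∃ L, Tendsto (oneArm σ) atTop (𝓝 L) :=
    ⟨_, tendsto_atTop_ciInf hanti ⟨0, by rintro _ ⟨n, rfl⟩; exact oneArm_nonneg n⟩⟩
  have h0 : 0 ≤ L := ge_of_tendsto' hL oneArm_nonneg
  have h1 : L ≤ 1 := le_of_tendsto' hL oneArm_le_one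
  have h2 : L = L * armRatio σ 1 L := by
    refine tendsto_nhds_unique ((tendsto_add_atTop_iff_nat 1).2 hL) ?_
    simp only [oneArm_add]
    exact hL.mul (((continuous_armRatio 1).tendsto L).comp hL)
  rcases h0.eq_or_lt with h | h
  · rwa [← h] at hL
  · have := armRatio_one_lt_one hσ h h1
    nlinarith

/-- A cylinder event is a finite disjoint union of events `agree h A`. For each of them the
conditional probability is an explicit continuous function of `oneArm σ m`, evaluated at 0 in the
limit. -/
theorem isIICMeasure_iicMeasure (hσ : 2 ≤ σ) : IsIICMeasure σ (iicMeasure σ) := by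
  classical
  have : NeZero σ := ⟨by omega⟩
  refine ⟨inferInstance, fun E hE => ?_⟩
  obtain ⟨h, hh, -⟩ := measurableSet_of_isCylinder hE
  have : ∀ n, IsProbabilityMeasure ((percolation σ (pc σ))[|connectedTo σ n]) := fun n =>
    cond_isProbabilityMeasure (by
      have := oneArm_pos (σ := σ) n
      rw [oneArm, Measure.real, ENNReal.toReal_pos_iff] at this
      exact this.1.ne')
  rw [← ENNReal.tendsto_toReal_iff (fun n => measure_ne_top _ _) (measure_ne_top _ _)]
  simp only [← Measure.real_def, measureReal_eq_sum_agree hh]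
  refine tendsto_finsetSum _ fun A _ => ?_
  rw [← tendsto_add_atTop_iff_nat h]
  have hcond : ∀ m, ((percolation σ (pc σ))[|connectedTo σ (m + h)]).real (agree h (A : Set (Edge σ)))
      = (percolation σ (pc σ)).real (agree h (A : Set (Edge σ))) *
        (∑ j ∈ Finset.range (clusterLevel h (A : Set (Edge σ))).card, (1 - oneArm σ m) ^ j)
        / armRatio σ h (oneArm σ m) := by
    intro m
    have hp := oneArm_pos (σ := σ) (m + h)
    rw [Measure.real, cond_apply (measurableSet_connectedTo _), ENNReal.toReal_mul,
      ENNReal.toReal_inv, ← Measure.real, ← Measure.real, percolation_agree_inter_connectedTo, ← oneArm]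
    rw [oneArm_add] at hp ⊢
    have := oneArm_pos (σ := σ) m
    have : armRatio σ h (oneArm σ m) ≠ 0 := fun h0 => by simp [h0] at hp
    field_simp
  simp only [hcond]
  have hlim := tendsto_oneArm hσ
  have h1 : Tendsto (fun m => armRatio σ h (oneArm σ m)) atTop (𝓝 1) := by
    have := ((continuous_armRatio (σ := σ) h).tendsto 0).comp hlim
    rwa [armRatio_zero] at this
  have h2 : Tendsto (fun m => ∑ j ∈ Finset.range (clusterLevel h (A : Set (Edge σ))).card,
      (1 - oneArm σ m) ^ j) atTop (𝓝 (clusterLevel h (A : Set (Edge σ))).card) := by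
    have hc : Continuous fun x : ℝ =>
      ∑ j ∈ Finset.range (clusterLevel h (A : Set (Edge σ))).card, (1 - x) ^ j := by fun_prop
    have := (hc.tendsto 0).comp hlim
    simpa [Function.comp_def] using this
  rw [iicMeasure_agree]
  have := (h2.const_mul ((percolation σ (pc σ)).real (agree h (A : Set (Edge σ))))).div h1
    one_ne_zero
  rwa [div_one] at this

/-- Cylinder events form a π-system that generates the σ-algebra. -/
theorem IsIICMeasure.unique {ν ν' : Measure (Set (Edge σ))} (h : IsIICMeasure σ ν)
    (h' : IsIICMeasure σ ν') : ν = ν' := by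
  have := h.isProbabilityMeasure
  have := h'.isProbabilityMeasure
  have heq : ∀ E : Set (Set (Edge σ)), IsCylinder E → ν E = ν' E := fun E hE =>
    tendsto_nhds_unique (h.tendsto_cond E hE) (h'.tendsto_cond E hE)
  refine ext_of_generate_finite {E | IsCylinder E} (le_antisymm ?_ ?_) ?_ (fun E hE => heq E hE)
    (by simp)
  · have : @Measurable _ _ (MeasurableSpace.generateFrom {E : Set (Set (Edge σ)) | IsCylinder E}) _
        (fun ω : Set (Edge σ) => ω) := by
      refine (@measurable_set_iff (Edge σ) (Set (Edge σ))
        (MeasurableSpace.generateFrom {E | IsCylinder E}) _).2 fun e => ?_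
      refine (@measurableSet_setOfPred (Set (Edge σ))
        (MeasurableSpace.generateFrom {E | IsCylinder E}) _).1 ?_
      exact MeasurableSpace.measurableSet_generateFrom ⟨{e}, fun ω ω' H => H e (by simp)⟩
    intro s hs
    exact this hs
  · refine MeasurableSpace.generateFrom_le fun E hE => ?_
    exact (measurableSet_of_isCylinder hE).choose_spec.2
  · rintro E ⟨F, hF⟩ E' ⟨F', hF'⟩ -
    classical
    exact ⟨F ∪ F', fun ω ω' H => and_congr
      (hF ω ω' fun e he => H e (Finset.mem_union_left _ he))
      (hF' ω ω' fun e he => H e (Finset.mem_union_right _ he))⟩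

end IIC

/-! ### Couplings -/

section Coupling

open scoped ENNReal

lemma sum_restrict_eq {Ω ι : Type*} [MeasurableSpace Ω] [Countable ι] (P : Measure Ω)
    {A : ι → Set Ω} (hA : ∀ i, MeasurableSet (A i))
    (hAd : Pairwise fun i j => Disjoint (A i) (A j)) (hAc : P (⋃ i, A i)ᶜ = 0) :
    Measure.sum (fun i => P.restrict (A i)) = P := by
  rw [← Measure.restrict_iUnion hAd hA]
  exact Measure.restrict_eq_self_of_ae_mem (mem_ae_iff.2 hAc)

/-- Two measure spaces with partitions into events of the same probabilities can be coupled so that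
the two points lie in corresponding events. -/
theorem exists_coupling_of_partition {Ω Ω' ι : Type*} [MeasurableSpace Ω] [MeasurableSpace Ω']
    [Countable ι] (P : Measure Ω) [IsProbabilityMeasure P] (Q : Measure Ω') [SFinite Q]
    {A : ι → Set Ω} {B : ι → Set Ω'} (hA : ∀ i, MeasurableSet (A i))
    (hB : ∀ i, MeasurableSet (B i)) (hAd : Pairwise fun i j => Disjoint (A i) (A j))
    (hBd : Pairwise fun i j => Disjoint (B i) (B j)) (hAc : P (⋃ i, A i)ᶜ = 0)
    (hBc : Q (⋃ i, B i)ᶜ = 0) (h : ∀ i, P (A i) = Q (B i)) :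
    ∃ γ : Measure (Ω × Ω'), IsCoupling γ P Q ∧ ∀ᵐ p ∂γ, ∃ i, p.1 ∈ A i ∧ p.2 ∈ B i := by
  -- Independent within each matched pair of cells. The factor gives the pair the mass `P (A i)`; it
  -- is `∞` for a null cell, where the product measure vanishes.
  set γ : Measure (Ω × Ω') :=
    Measure.sum fun i => (P (A i))⁻¹ • (P.restrict (A i)).prod (Q.restrict (B i)) with hγ
  have hfst : γ.map Prod.fst = P := by
    rw [hγ, Measure.map_sum measurable_fst.aemeasurable]
    conv_rhs => rw [← sum_restrict_eq P hA hAd hAc]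
    congr 1
    funext i
    rw [Measure.map_smul, Measure.map_fst_prod, Measure.restrict_apply_univ, ← h, smul_smul]
    by_cases h0 : P (A i) = 0
    · rw [Measure.restrict_eq_zero.2 h0, smul_zero]
    · rw [ENNReal.inv_mul_cancel h0 (measure_ne_top _ _), one_smul]
  have hsnd : γ.map Prod.snd = Q := by
    rw [hγ, Measure.map_sum measurable_snd.aemeasurable]
    conv_rhs => rw [← sum_restrict_eq Q hB hBd hBc]
    congr 1
    funext i
    rw [Measure.map_smul, Measure.map_snd_prod, Measure.restrict_apply_univ, smul_smul]
    by_cases h0 : P (A i) = 0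
    · rw [Measure.restrict_eq_zero.2 ((h i).symm.trans h0), smul_zero]
    · rw [ENNReal.inv_mul_cancel h0 (measure_ne_top _ _), one_smul]
  refine ⟨γ, ⟨⟨?_⟩, hfst, hsnd⟩, ?_⟩
  · rw [← Set.preimage_univ (f := Prod.fst), ← Measure.map_apply measurable_fst .univ, hfst,
      measure_univ]
  · rw [hγ, Measure.ae_sum_iff]
    intro i
    refine Measure.ae_smul_measure ?_ _
    rw [Measure.prod_restrict]
    filter_upwards [ae_restrict_mem ((hA i).prod (hB i))] with p hp
    exact ⟨i, hp.1, hp.2⟩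

/-! ### Weak limits of monotone couplings -/

variable {V : Type*}

/-- A set as a point of the Cantor space. -/
noncomputable def toBool (s : Set V) : V → Bool := fun v => by classical exact decide (v ∈ s)

lemma toBool_eq_true {s : Set V} {v : V} : toBool s v = true ↔ v ∈ s := by simp [toBool]

lemma measurable_toBool : Measurable (toBool : Set V → V → Bool) := by
  refine measurable_pi_iff.2 fun v => measurable_to_bool ?_
  have : (fun s : Set V => toBool s v) ⁻¹' {true} = {s | v ∈ s} := by
    ext s; simp [toBool_eq_true]
  rw [this]
  exact measurableSet_mem v

/-- A point of the Cantor space as a set. -/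
def ofBool (x : V → Bool) : Set V := {v | x v = true}

lemma measurable_ofBool : Measurable (ofBool : (V → Bool) → Set V) := by
  refine measurable_set_iff.2 fun v => measurableSet_setOfPred.1 ?_
  exact measurable_pi_apply (X := fun _ : V => Bool) v (measurableSet_singleton true)

lemma ofBool_toBool (s : Set V) : ofBool (toBool s) = s := by
  ext v; simp [ofBool, toBool_eq_true]

/-- Couplings with an increasing sequence of random sets, all of them contained in the second set,
pass to the limit. -/
theorem exists_coupling_of_tendsto [Countable V] {Ω : Type*} [MeasurableSpace Ω] (P : Measure Ω)
    [IsProbabilityMeasure P] {X : ℕ → Ω → Set V} {Y : Ω → Set V} (hX : ∀ n, Measurable (X n))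
    (hY : Measurable Y) (hXY : ∀ ω v, ∀ᶠ n in atTop, v ∈ X n ω ↔ v ∈ Y ω) (ν : Measure (Set V))
    (h : ∀ n, ∃ γ : Measure (Set V × Set V), IsCoupling γ (P.map (X n)) ν ∧ ∀ᵐ c ∂γ, c.1 ⊆ c.2) :
    ∃ γ : Measure (Set V × Set V), IsCoupling γ (P.map Y) ν ∧ ∀ᵐ c ∂γ, c.1 ⊆ c.2 := by
  choose γ hγ hsub using h
  have hpair : Measurable (Prod.map toBool toBool : Set V × Set V → (V → Bool) × (V → Bool)) :=
    measurable_toBool.prodMap measurable_toBool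
  have hunpair : Measurable (Prod.map ofBool ofBool : (V → Bool) × (V → Bool) → Set V × Set V) :=
    measurable_ofBool.prodMap measurable_ofBool
  have hprob : ∀ n, IsProbabilityMeasure ((γ n).map (Prod.map toBool toBool)) := fun n =>
    have := (hγ n).isProbabilityMeasure
    Measure.isProbabilityMeasure_map hpair.aemeasurable
  let Γ : ℕ → ProbabilityMeasure ((V → Bool) × (V → Bool)) := fun n => ⟨_, hprob n⟩
  -- Probability measures on the compact space of pairs of Boolean functions form a compact space. A
  -- limit along an ultrafilter finer than `atTop` takes the place of a convergent subsequence.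
  obtain ⟨G, -, hG⟩ := (isCompact_univ (X := ProbabilityMeasure ((V → Bool) × (V → Bool)))
    ).ultrafilter_le_nhds ((Ultrafilter.of atTop).map Γ) (by simp)
  have hlim : Tendsto Γ (Ultrafilter.of (atTop : Filter ℕ)) (𝓝 G) := hG
  have hle : (Ultrafilter.of (atTop : Filter ℕ) : Filter ℕ) ≤ atTop := Ultrafilter.of_le _
  have hfst : (G : Measure ((V → Bool) × (V → Bool))).map Prod.fst = P.map (fun ω => toBool (Y ω)) := by
    have hpY : IsProbabilityMeasure (P.map fun ω => toBool (Y ω)) :=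
      Measure.isProbabilityMeasure_map (measurable_toBool.comp hY).aemeasurable
    obtain ⟨M, hM⟩ : ∃ M : ProbabilityMeasure (V → Bool),
        M.toMeasure = P.map fun ω => toBool (Y ω) := ⟨⟨_, hpY⟩, rfl⟩
    have h1 := ProbabilityMeasure.tendsto_map_of_tendsto_of_continuous Γ G hlim continuous_fst
    have h2 : Tendsto (fun n => (Γ n).map (f := Prod.fst) continuous_fst.measurable.aemeasurable)
        atTop (𝓝 M) := by
      rw [ProbabilityMeasure.tendsto_iff_forall_integral_tendsto]
      intro f
      have e1 : ∀ n, ∫ x, f x ∂(((Γ n).map (f := Prod.fst)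
          continuous_fst.measurable.aemeasurable : ProbabilityMeasure (V → Bool)) : Measure _)
          = ∫ ω, f (toBool (X n ω)) ∂P := by
        intro n
        have : (((Γ n).map (f := Prod.fst) continuous_fst.measurable.aemeasurable :
            ProbabilityMeasure (V → Bool)) : Measure _) = P.map (fun ω => toBool (X n ω)) := by
          rw [ProbabilityMeasure.toMeasure_map]
          change ((γ n).map (Prod.map toBool toBool)).map Prod.fst = _
          rw [Measure.map_map measurable_fst hpair]
          change (γ n).map (toBool ∘ Prod.fst) = _
          rw [← Measure.map_map measurable_toBool measurable_fst, (hγ n).fst_eq,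
            Measure.map_map measurable_toBool (hX n)]
          rfl
        rw [this]
        exact integral_map (measurable_toBool.comp (hX n)).aemeasurable
          f.continuous.stronglyMeasurable.aestronglyMeasurable
      have e2 : ∫ x, f x ∂(P.map fun ω => toBool (Y ω)) = ∫ ω, f (toBool (Y ω)) ∂P :=
        integral_map (measurable_toBool.comp hY).aemeasurable
          f.continuous.stronglyMeasurable.aestronglyMeasurable
      simp only [e1]
      rw [hM, e2]
      -- Membership of each vertex is eventually constant, so the random sets converge pointwise in
      -- the product topology and the first marginals converge weakly.
      refine tendsto_integral_of_dominated_convergence (fun _ => ‖f‖) (fun n => ?_)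
        (integrable_const _) (fun n => ae_of_all _ fun ω => f.norm_coe_le_norm _)
        (ae_of_all _ fun ω => ?_)
      · exact (f.continuous.measurable.comp
          (measurable_toBool.comp (hX n))).aestronglyMeasurable
      · refine (f.continuous.tendsto _).comp (tendsto_pi_nhds.2 fun v => ?_)
        refine tendsto_const_nhds.congr' ?_
        filter_upwards [hXY ω v] with n hn
        rw [Bool.eq_iff_iff, toBool_eq_true, toBool_eq_true, hn]
    have := tendsto_nhds_unique h1 (h2.mono_left hle)
    rw [← hM, ← this]
    rfl
  have hsnd : (G : Measure ((V → Bool) × (V → Bool))).map Prod.snd = ν.map toBool := by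
    have h1 := ProbabilityMeasure.tendsto_map_of_tendsto_of_continuous Γ G hlim continuous_snd
    have h2 : ∀ n, (((Γ n).map (f := Prod.snd) continuous_snd.measurable.aemeasurable :
        ProbabilityMeasure (V → Bool)) : Measure _) = ν.map toBool := by
      intro n
      rw [ProbabilityMeasure.toMeasure_map]
      change ((γ n).map (Prod.map toBool toBool)).map Prod.snd = _
      rw [Measure.map_map measurable_snd hpair]
      change (γ n).map (toBool ∘ Prod.snd) = _
      rw [← Measure.map_map measurable_toBool measurable_snd, (hγ n).snd_eq]
    have h3 : ∀ n, (Γ n).map (f := Prod.snd) continuous_snd.measurable.aemeasurable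
        = (Γ 0).map (f := Prod.snd) continuous_snd.measurable.aemeasurable := fun n =>
      Subtype.ext ((h2 n).trans (h2 0).symm)
    have := tendsto_nhds_unique h1 (tendsto_const_nhds.congr fun n => (h3 n).symm)
    rw [← h2 0, ← this]
    rfl
  -- Inclusion is a closed condition, so by the portmanteau theorem it keeps full probability in the
  -- limit.
  have hclosed : IsClosed {x : (V → Bool) × (V → Bool) | ∀ v, x.1 v ≤ x.2 v} := by
    simp only [Set.ofPred_forall]
    exact isClosed_iInter fun v => (isClosed_discrete {p : Bool × Bool | p.1 ≤ p.2}).preimage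
      (f := fun x : (V → Bool) × (V → Bool) => (x.1 v, x.2 v)) (by fun_prop)
  have hae : ∀ᵐ x ∂(G : Measure ((V → Bool) × (V → Bool))), ∀ v, x.1 v ≤ x.2 v := by
    have h1 := ProbabilityMeasure.limsup_measure_closed_le_of_tendsto hlim hclosed
    have h2 : ∀ n, (Γ n : Measure _) {x : (V → Bool) × (V → Bool) | ∀ v, x.1 v ≤ x.2 v} = 1 := by
      intro n
      rw [← mem_ae_iff_prob_eq_one hclosed.measurableSet]
      change ∀ᵐ x ∂((γ n).map (Prod.map toBool toBool)), ∀ v, x.1 v ≤ x.2 v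
      rw [ae_map_iff hpair.aemeasurable hclosed.measurableSet]
      filter_upwards [hsub n] with c hc v hv
      exact toBool_eq_true.2 (hc (toBool_eq_true.1 hv))
    simp only [h2, limsup_const] at h1
    exact (mem_ae_iff_prob_eq_one hclosed.measurableSet).2 (le_antisymm prob_le_one h1)
  refine ⟨(G : Measure ((V → Bool) × (V → Bool))).map (Prod.map ofBool ofBool), ⟨?_, ?_, ?_⟩, ?_⟩
  · exact Measure.isProbabilityMeasure_map hunpair.aemeasurable
  · rw [Measure.map_map measurable_fst hunpair]
    change (G : Measure ((V → Bool) × (V → Bool))).map (ofBool ∘ Prod.fst) = _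
    rw [← Measure.map_map measurable_ofBool measurable_fst, hfst,
      Measure.map_map (f := fun ω => toBool (Y ω)) measurable_ofBool (measurable_toBool.comp hY)]
    exact congrArg (fun f => P.map f) (funext fun ω => ofBool_toBool (Y ω))
  · rw [Measure.map_map measurable_snd hunpair]
    change (G : Measure ((V → Bool) × (V → Bool))).map (ofBool ∘ Prod.snd) = _
    rw [← Measure.map_map measurable_ofBool measurable_snd, hsnd,
      Measure.map_map measurable_ofBool measurable_toBool]
    rw [show ofBool ∘ toBool = (id : Set V → Set V) from funext ofBool_toBool, Measure.map_id]
  · rw [ae_map_iff hunpair.aemeasurable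
      (measurableSet_setOfPred.2 (measurable_fst.subset measurable_snd))]
    filter_upwards [hae] with x hx v hv
    exact hx v hv

end Coupling

/-! ### Trees with a spine -/

section Spine

variable {σ : ℕ}

/-- A finite subtree with a single vertex at its maximal height, the end of its spine. -/
structure IsSpineTree (v : Vertex σ) (S : Finset (Vertex σ)) : Prop where
  nil_mem : [] ∈ S
  mem_of_cons : ∀ i u, i :: u ∈ S → u ∈ S
  end_mem : v ∈ S
  height : ∀ u ∈ S, u.length < v.length ∨ u = v

lemma IsSpineTree.mem_of_suffix {v : Vertex σ} {S : Finset (Vertex σ)} (h : IsSpineTree v S)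
    {u x : Vertex σ} (hux : u <:+ x) (hx : x ∈ S) : u ∈ S := by
  induction x with
  | nil => rwa [List.suffix_nil.1 hux]
  | cons i x ih =>
    rcases List.suffix_cons_iff.1 hux with rfl | h'
    · exact hx
    · exact ih h' (h.mem_of_cons i x hx)

/-- Applied with the invaded set it supplies a boundary edge on the path to `v`; applied with a
spine tree `S` it supplies an edge that was rejected. -/
lemma exists_exit_edge {I : Set (Vertex σ)} {u v : Vertex σ} (huv : u <:+ v) (hu : u ∈ I)
    (hv : v ∉ I) : ∃ i x, i :: x <:+ v ∧ u <:+ x ∧ x ∈ I ∧ i :: x ∉ I := by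
  induction v with
  | nil => exact absurd (List.suffix_nil.1 huv ▸ hu) hv
  | cons j v ih =>
    rcases List.suffix_cons_iff.1 huv with rfl | h'
    · exact absurd hu hv
    · by_cases hvI : v ∈ I
      · exact ⟨j, v, List.suffix_refl _, h', hvI, hv⟩
      · obtain ⟨i, x, h1, h2⟩ := ih h' hvI
        exact ⟨i, x, h1.trans (List.suffix_cons j v), h2⟩

lemma eq_of_suffix_of_suffix {u u' v : Vertex σ} (h : u <:+ v) (h' : u' <:+ v)
    (hl : u.length = u'.length) : u = u' :=
  (List.suffix_of_suffix_length_le h h' hl.le).eq_of_length hl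

lemma exists_branch_point {v v' : Vertex σ} (hl : v.length = v'.length) (hne : v ≠ v') :
    ∃ x i i', i ≠ i' ∧ i :: x <:+ v ∧ i' :: x <:+ v' := by
  induction v generalizing v' with
  | nil => exact absurd (List.length_eq_zero_iff.1 hl.symm).symm hne
  | cons a t ih =>
    cases v' with
    | nil => simp at hl
    | cons a' t' =>
      by_cases ht : t = t'
      · subst ht
        exact ⟨t, a, a', fun h => hne (by rw [h]), List.suffix_refl _, List.suffix_refl _⟩
      · obtain ⟨x, i, i', h1, h2, h3⟩ := ih (by simpa using hl) ht
        exact ⟨x, i, i', h1, h2.trans (List.suffix_cons _ _), h3.trans (List.suffix_cons _ _)⟩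

/-- The height of the last common vertex of the paths from the root to `v` and to `u`. -/
def meet (v : Vertex σ) : Vertex σ → ℕ
  | [] => 0
  | i :: u => if i :: u <:+ v then u.length + 1 else meet v u

lemma meet_of_suffix {u v : Vertex σ} (h : u <:+ v) : meet v u = u.length := by
  cases u with
  | nil => rfl
  | cons i u => rw [meet, if_pos h, List.length_cons]

lemma meet_cons_of_not_suffix {u v : Vertex σ} {i : Fin σ} (h : ¬ i :: u <:+ v) :
    meet v (i :: u) = meet v u := by rw [meet, if_neg h]

lemma exists_suffix_meet (v u : Vertex σ) : ∃ x, x <:+ v ∧ x <:+ u ∧ x.length = meet v u := by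
  induction u with
  | nil => exact ⟨[], List.nil_suffix, List.nil_suffix, rfl⟩
  | cons i u ih =>
    by_cases h : i :: u <:+ v
    · exact ⟨i :: u, h, List.suffix_refl _, (meet_of_suffix h).symm⟩
    · obtain ⟨x, h1, h2, h3⟩ := ih
      exact ⟨x, h1, h2.trans (List.suffix_cons _ _), by rw [h3, meet_cons_of_not_suffix h]⟩

lemma not_suffix_of_branch {v v' x u : Vertex σ} {i i' j : Fin σ} (hii : i ≠ i')
    (hv : i :: x <:+ v) (hv' : i' :: x <:+ v') (hu : j :: u <:+ v') (hxu : x <:+ u) :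
    ¬ j :: u <:+ v := by
  intro h
  have h1 : i' :: x <:+ j :: u := List.suffix_of_suffix_length_le hv' hu (by
    have := hxu.length_le; simpa using this)
  have := eq_of_suffix_of_suffix hv (h1.trans h) rfl
  exact hii (List.cons.inj this).1

/-- A path that has left the path to `v` never rejoins it, so the threshold `pathMax w v (meet v ·)`
is constant along a branch. -/
lemma meet_of_branch {v v' x u : Vertex σ} {i i' : Fin σ} (hii : i ≠ i')
    (hv : i :: x <:+ v) (hv' : i' :: x <:+ v') (hu : u <:+ v') (hxu : x <:+ u) :
    meet v u = x.length := by
  induction u with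
  | nil => rw [List.suffix_nil.1 hxu]; rfl
  | cons j u ih =>
    rcases List.suffix_cons_iff.1 hxu with h | h
    · rw [← h]
      exact meet_of_suffix ((List.suffix_cons _ _).trans hv)
    · rw [meet_cons_of_not_suffix (not_suffix_of_branch hii hv hv' hu h)]
      exact ih ((List.suffix_cons _ _).trans hu) h

/-! ### Maximal weights along paths -/

/-- The weight of the edge at height `j` of the path from the root to a vertex. -/
def spineWeight (w : Edge σ → ℝ) : Vertex σ → ℕ → ℝ
  | [], _ => 0
  | i :: u, j => if j = u.length then w (u, i) else spineWeight w u j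

lemma spineWeight_of_suffix {w : Edge σ → ℝ} {v u : Vertex σ} {i : Fin σ} (h : i :: u <:+ v) :
    spineWeight w v u.length = w (u, i) := by
  induction v with
  | nil => simp at h
  | cons j v ih =>
    rw [spineWeight]
    rcases List.suffix_cons_iff.1 h with h' | h'
    · obtain ⟨rfl, rfl⟩ := List.cons.inj h'
      simp
    · rw [if_neg, ih h']
      have := h'.length_le
      simp at this
      omega

lemma exists_suffix_of_lt {v : Vertex σ} {j : ℕ} (hj : j < v.length) :
    ∃ i u, i :: u <:+ v ∧ u.length = j := by
  induction v with
  | nil => simp at hj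
  | cons i v ih =>
    rcases Nat.lt_succ_iff_lt_or_eq.1 hj with h | h
    · obtain ⟨i', u, h1, h2⟩ := ih h
      exact ⟨i', u, h1.trans (List.suffix_cons _ _), h2⟩
    · exact ⟨i, v, List.suffix_refl _, h.symm⟩

/-- The maximum of `0` and of `y j` for `k ≤ j < n`. -/
def tailMax (y : ℕ → ℝ) (k : ℕ) : ℕ → ℝ
  | 0 => 0
  | n + 1 => max (tailMax y k n) (if k ≤ n then y n else 0)

lemma tailMax_nonneg (y : ℕ → ℝ) (k n : ℕ) : 0 ≤ tailMax y k n := by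
  induction n with
  | zero => exact le_rfl
  | succ n ih => exact ih.trans (le_max_left _ _)

lemma tailMax_le_iff {y : ℕ → ℝ} {k n : ℕ} {c : ℝ} (hc : 0 ≤ c) :
    tailMax y k n ≤ c ↔ ∀ j, k ≤ j → j < n → y j ≤ c := by
  induction n with
  | zero => simpa [tailMax] using hc
  | succ n ih =>
    rw [tailMax, max_le_iff, ih]
    constructor
    · rintro ⟨h1, h2⟩ j hk hj
      rcases Nat.lt_succ_iff_lt_or_eq.1 hj with h | rfl
      · exact h1 j hk h
      · simpa [hk] using h2
    · intro h
      refine ⟨fun j hk hj => h j hk (by omega), ?_⟩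
      split_ifs with hk
      · exact h n hk (by omega)
      · exact hc

lemma le_tailMax {y : ℕ → ℝ} {k n j : ℕ} (hk : k ≤ j) (hj : j < n) : y j ≤ tailMax y k n :=
  (tailMax_le_iff (tailMax_nonneg y k n)).1 le_rfl j hk hj

lemma tailMax_anti {y : ℕ → ℝ} {k k' n : ℕ} (hk : k ≤ k') : tailMax y k' n ≤ tailMax y k n :=
  (tailMax_le_iff (tailMax_nonneg y k n)).2 fun _ h hj => le_tailMax (hk.trans h) hj

lemma tailMax_congr {y y' : ℕ → ℝ} {k n : ℕ} (h : ∀ j < n, y j = y' j) :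
    tailMax y k n = tailMax y' k n := by
  induction n with
  | zero => rfl
  | succ n ih => rw [tailMax, tailMax, ih fun j hj => h j (by omega), h n (by omega)]

lemma tailMax_lt_one {y : ℕ → ℝ} {k n : ℕ} (h : ∀ j, y j < 1) : tailMax y k n < 1 := by
  induction n with
  | zero => exact one_pos
  | succ n ih =>
    rw [tailMax, max_lt_iff]
    refine ⟨ih, ?_⟩
    split_ifs
    · exact h n
    · exact one_pos

/-- Positivity ensures that the maximum is not the default value 0. -/
lemma exists_eq_tailMax {y : ℕ → ℝ} {k n : ℕ} (hy : ∀ j < n, 0 < y j) (hk : k < n) :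
    ∃ j, k ≤ j ∧ j < n ∧ tailMax y k n = y j := by
  induction n with
  | zero => omega
  | succ n ih =>
    rw [tailMax, if_pos (by omega)]
    rcases le_total (tailMax y k n) (y n) with h | h
    · exact ⟨n, by omega, by omega, max_eq_right h⟩
    · have hkn : k < n := by
        rcases Nat.lt_succ_iff_lt_or_eq.1 hk with h' | rfl
        · exact h'
        · exfalso
          have : tailMax y k k ≤ 0 := (tailMax_le_iff le_rfl).2 fun j h1 h2 => by omega
          linarith [hy k (by omega)]
      obtain ⟨j, h1, h2, h3⟩ := ih (fun j hj => hy j (by omega)) hkn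
      exact ⟨j, h1, by omega, by rw [max_eq_left h, h3]⟩

/-- The maximal weight on the part above height `k` of the path from the root to `v`. -/
def pathMax (w : Edge σ → ℝ) (v : Vertex σ) (k : ℕ) : ℝ := tailMax (spineWeight w v) k v.length

lemma pathMax_nonneg (w : Edge σ → ℝ) (v : Vertex σ) (k : ℕ) : 0 ≤ pathMax w v k :=
  tailMax_nonneg _ _ _

lemma le_pathMax {w : Edge σ → ℝ} {v u : Vertex σ} {i : Fin σ} {k : ℕ} (h : i :: u <:+ v)
    (hk : k ≤ u.length) : w (u, i) ≤ pathMax w v k := by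
  rw [← spineWeight_of_suffix (w := w) h]
  exact le_tailMax hk (by simpa using h.length_le)

lemma pathMax_le_iff {w : Edge σ → ℝ} {v : Vertex σ} {k : ℕ} {c : ℝ} (hc : 0 ≤ c) :
    pathMax w v k ≤ c ↔ ∀ i u, i :: u <:+ v → k ≤ u.length → w (u, i) ≤ c := by
  rw [pathMax, tailMax_le_iff hc]
  constructor
  · intro h i u hu hk
    rw [← spineWeight_of_suffix (w := w) hu]
    exact h _ hk (by simpa using hu.length_le)
  · intro h j hk hj
    obtain ⟨i, u, hu, rfl⟩ := exists_suffix_of_lt hj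
    rw [spineWeight_of_suffix hu]
    exact h i u hu hk

lemma pathMax_anti {w : Edge σ → ℝ} {v : Vertex σ} {k k' : ℕ} (h : k ≤ k') :
    pathMax w v k' ≤ pathMax w v k := tailMax_anti h

lemma exists_eq_pathMax {w : Edge σ → ℝ} (hw : ∀ e, 0 < w e) {v : Vertex σ} {k : ℕ}
    (hk : k < v.length) : ∃ i u, i :: u <:+ v ∧ k ≤ u.length ∧ pathMax w v k = w (u, i) := by
  obtain ⟨j, h1, h2, h3⟩ := exists_eq_tailMax (y := spineWeight w v) (k := k) (n := v.length)
    (fun j hj => by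
      obtain ⟨i, u, hu, rfl⟩ := exists_suffix_of_lt hj
      rw [spineWeight_of_suffix hu]
      exact hw _) hk
  obtain ⟨i, u, hu, rfl⟩ := exists_suffix_of_lt h2
  exact ⟨i, u, hu, h1, by rw [pathMax, h3, spineWeight_of_suffix hu]⟩

/-! ### Spine trees determined by thresholds -/

/-- The edges that leave the vertices of `S` other than `v` and are not on the path to `v`. -/
def offEdges (v : Vertex σ) (S : Finset (Vertex σ)) : Finset (Edge σ) :=
  (S.erase v ×ˢ Finset.univ).filter (· ∉ spineEdges v)

lemma mem_offEdges {v : Vertex σ} {S : Finset (Vertex σ)} {e : Edge σ} :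
    e ∈ offEdges v S ↔ e.1 ∈ S ∧ e.1 ≠ v ∧ ¬ e.2 :: e.1 <:+ v := by
  simp [offEdges, mem_spineEdges, and_assoc, and_left_comm]

/-- The event that `S` is the tree that consists of the path to `v` and of the branches on which
the values are at most `t`. -/
def spineEvent (v : Vertex σ) (S : Finset (Vertex σ)) (t : Edge σ → ℝ) : Set (Edge σ → ℝ) :=
  {x | ∀ e ∈ offEdges v S, x e ≤ t e ↔ e.2 :: e.1 ∈ S}

/-- By induction on the height: once the parent is known to be in both trees, the child is decided
by the path to `v` or by one threshold comparison. -/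
lemma eq_of_mem_spineEvent {v : Vertex σ} {S S' : Finset (Vertex σ)} (hS : IsSpineTree v S)
    (hS' : IsSpineTree v S') {t x : Edge σ → ℝ} (hx : x ∈ spineEvent v S t)
    (hx' : x ∈ spineEvent v S' t) : S = S' := by
  ext u
  induction u with
  | nil => exact iff_of_true hS.nil_mem hS'.nil_mem
  | cons i u ih =>
    by_cases hs : i :: u <:+ v
    · exact iff_of_true (hS.mem_of_suffix hs hS.end_mem) (hS'.mem_of_suffix hs hS'.end_mem)
    · by_cases hu : u ∈ S
      · by_cases huv : u = v
        · subst huv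
          refine iff_of_false (fun h => ?_) (fun h => ?_)
          · simpa using hS.height _ h
          · simpa using hS'.height _ h
        · exact (hx (u, i) (mem_offEdges.2 ⟨hu, huv, hs⟩)).symm.trans
            (hx' (u, i) (mem_offEdges.2 ⟨ih.1 hu, huv, hs⟩))
      · exact iff_of_false (fun h => hu (hS.mem_of_cons _ _ h))
          fun h => hu (ih.2 (hS'.mem_of_cons _ _ h))

/-- The tree is the root cluster, cut at the height of `v`, when the path edges and the edges with
`x e ≤ t e` are open. The hypothesis says that no other vertex of that height is reached. -/
lemma exists_spineTree {v : Vertex σ} {t x : Edge σ → ℝ}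
    (h : ∀ u : Vertex σ, u.length = v.length →
      (∀ i y, i :: y <:+ u → ¬ i :: y <:+ v → x (y, i) ≤ t (y, i)) → u = v) :
    ∃ S, IsSpineTree v S ∧ x ∈ spineEvent v S t := by
  classical
  set ω : Set (Edge σ) := {e | e.2 :: e.1 <:+ v ∨ x e ≤ t e} with hω
  refine ⟨(List.finite_length_le (Fin σ) v.length).toFinset.filter (· ∈ cluster ω),
    ⟨?_, ?_, ?_, ?_⟩, ?_⟩
  · simp
  · intro i u hu
    simp only [Finset.mem_filter, Set.Finite.mem_toFinset, Set.mem_ofPred_eq, List.length_cons,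
      cons_mem_cluster] at hu ⊢
    exact ⟨by omega, hu.2.1⟩
  · simp only [Finset.mem_filter, Set.Finite.mem_toFinset, Set.mem_ofPred_eq, le_refl, true_and]
    exact mem_cluster_iff_forall_suffix.2 fun i u hu => .inl hu
  · intro u hu
    simp only [Finset.mem_filter, Set.Finite.mem_toFinset, Set.mem_ofPred_eq] at hu
    rcases hu.1.lt_or_eq with h' | h'
    · exact .inl h'
    · exact .inr (h u h' fun i y hy hn =>
        (mem_cluster_iff_forall_suffix.1 hu.2 i y hy).resolve_left hn)
  · intro e he
    obtain ⟨h1, h2, h3⟩ := mem_offEdges.1 he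
    simp only [Finset.mem_filter, Set.Finite.mem_toFinset, Set.mem_ofPred_eq, List.length_cons,
      cons_mem_cluster, h3, false_or, hω] at h1 ⊢
    have : e.1.length < v.length := by
      refine lt_of_le_of_ne h1.1 fun hl => h2 (h _ hl fun i y hy hn => ?_)
      exact (mem_cluster_iff_forall_suffix.1 h1.2 i y hy).resolve_left hn
    exact ⟨fun hle => ⟨by omega, h1.2, hle⟩, fun H => H.2.2⟩

/-! ### The minimax vertex and its tree -/

/-- The event that the part of the invaded cluster found before `v` is reached is `S`. -/
def treeEvent (v : Vertex σ) (S : Finset (Vertex σ)) : Set (Edge σ → ℝ) :=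
  {w | w ∈ spineEvent v S fun e => pathMax w v (meet v e.1)}

/-- The path to `v'` has to leave `S`, whose only vertex of that height is `v`. The edge by which it
leaves was rejected, so its weight exceeds the path maximum of `v` beyond the branch point. Two
different end vertices would give this strict inequality in both directions. -/
lemma pathMax_lt_of_branch {v v' x : Vertex σ} {i i' : Fin σ} {S : Finset (Vertex σ)}
    (hl : v.length = v'.length) (hne : v' ≠ v) (hii : i ≠ i') (hv : i :: x <:+ v)
    (hv' : i' :: x <:+ v') (hS : IsSpineTree v S) {w : Edge σ → ℝ} (hw : w ∈ treeEvent v S) :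
    pathMax w v x.length < pathMax w v' x.length := by
  have hx : x ∈ (S : Set (Vertex σ)) :=
    hS.mem_of_suffix ((List.suffix_cons _ _).trans hv) hS.end_mem
  have hnot : v' ∉ (S : Set (Vertex σ)) := fun h => by
    rcases hS.height v' h with h' | h'
    · omega
    · exact hne h'
  obtain ⟨j, u, h1, h2, h3, h4⟩ := exists_exit_edge ((List.suffix_cons _ _).trans hv') hx hnot
  have hoff : (u, j) ∈ offEdges v S := by
    refine mem_offEdges.2 ⟨h3, ?_, not_suffix_of_branch hii hv hv' h1 h2⟩
    intro huv
    have huv' : u = v := huv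
    have := h1.length_le
    rw [huv', List.length_cons] at this
    omega
  have h5 := (hw (u, j) hoff).not.2 h4
  rw [not_le] at h5
  simp only [meet_of_branch hii hv hv' ((List.suffix_cons _ _).trans h1) h2] at h5
  exact h5.trans_le (le_pathMax h1 h2.length_le)

lemma eq_of_mem_treeEvent {v v' : Vertex σ} {S S' : Finset (Vertex σ)}
    (hl : v.length = v'.length) (hS : IsSpineTree v S) (hS' : IsSpineTree v' S')
    {w : Edge σ → ℝ} (hw : w ∈ treeEvent v S) (hw' : w ∈ treeEvent v' S') : v = v' ∧ S = S' := by
  by_cases hvv : v = v'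
  · subst hvv
    exact ⟨rfl, eq_of_mem_spineEvent hS hS' hw hw'⟩
  · obtain ⟨x, i, i', hii, hx, hx'⟩ := exists_branch_point hl hvv
    exact absurd (pathMax_lt_of_branch hl (Ne.symm hvv) hii hx hx' hS hw)
      (pathMax_lt_of_branch hl.symm hvv hii.symm hx' hx hS' hw').le.not_gt

/-- Dynamic programming: take an optimal continuation through each child and keep the one with the
smallest maximum from `x`. Optimality is needed from every vertex of the path at once, because each
branch point has its own threshold. -/
lemma exists_optimal_vertex [NeZero σ] (w : Edge σ → ℝ) (l : ℕ) (x : Vertex σ) :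
    ∃ v, x <:+ v ∧ v.length = x.length + l ∧ ∀ y, x <:+ y → y <:+ v → ∀ v', y <:+ v' →
      v'.length = v.length → pathMax w v y.length ≤ pathMax w v' y.length := by
  induction l generalizing x with
  | zero =>
    refine ⟨x, List.suffix_refl _, rfl, fun y hxy hyx v' hyv' hl => ?_⟩
    have h1 : y = x := hyx.eq_of_length (le_antisymm hyx.length_le hxy.length_le)
    subst h1
    rw [hyv'.eq_of_length hl.symm]
  | succ l ih =>
    choose c hc hcl hopt using fun i => ih (i :: x)
    obtain ⟨i, -, hi⟩ := Finset.exists_min_image (Finset.univ : Finset (Fin σ))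
      (fun i => pathMax w (c i) x.length) Finset.univ_nonempty
    have hlen : (c i).length = x.length + (l + 1) := by
      rw [hcl, List.length_cons]; omega
    refine ⟨c i, (List.suffix_cons _ _).trans (hc i), hlen, fun y hxy hy v' hyv' hl => ?_⟩
    by_cases hyx : y = x
    · subst hyx
      obtain ⟨t, ht⟩ := hyv'
      rcases List.eq_nil_or_concat t with rfl | ⟨t', i', rfl⟩
      · exfalso
        rw [hlen, ← ht] at hl
        simp at hl
      have hv' : i' :: y <:+ v' := ⟨t', by rw [← ht]; simp⟩
      refine (hi i' (Finset.mem_univ _)).trans ?_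
      -- The continuation through `i'` shares its first edge with `v'`, and its later edges are
      -- controlled by its optimality from `i' :: y`.
      refine (pathMax_le_iff (pathMax_nonneg _ _ _)).2 fun j u hu hju => ?_
      rcases hju.eq_or_lt with h | h
      · have h1 : i' :: y = j :: u := eq_of_suffix_of_suffix (hc i') hu (by simp [h])
        rw [← (List.cons.inj h1).1, ← (List.cons.inj h1).2]
        exact le_pathMax hv' le_rfl
      · calc w (u, j) ≤ pathMax w (c i') (i' :: y).length := le_pathMax hu (by simpa using h)
          _ ≤ pathMax w v' (i' :: y).length := hopt i' _ (List.suffix_refl _) (hc i') v' hv'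
              (by rw [hl, hlen, hcl, List.length_cons]; omega)
          _ ≤ pathMax w v' y.length := pathMax_anti (by simp)
    · refine hopt i y ?_ hy v' hyv' hl
      refine List.suffix_of_suffix_length_le (hc i) hy ?_
      rw [List.length_cons]
      exact lt_of_le_of_ne hxy.length_le fun h => hyx (hxy.eq_of_length h).symm

/-- A second vertex of height `n` within all thresholds would tie with the optimal one beyond their
branch point. The two maxima are attained at different edges, so injective weights exclude a tie. -/
lemma exists_mem_treeEvent [NeZero σ] {w : Edge σ → ℝ} (hinj : Function.Injective w)
    (hpos : ∀ e, 0 < w e) (n : ℕ) : ∃ v S, v.length = n ∧ IsSpineTree v S ∧ w ∈ treeEvent v S := by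
  obtain ⟨v, -, hl, hopt⟩ := exists_optimal_vertex w n []
  simp only [List.length_nil, zero_add] at hl
  obtain ⟨S, hS, hw⟩ := exists_spineTree (v := v) (x := w)
    (t := fun e => pathMax w v (meet v e.1)) fun u hul hu => by
      by_contra hne
      obtain ⟨x, i, i', hii, hx, hx'⟩ := exists_branch_point hul.symm (Ne.symm hne)
      have hxv : x <:+ v := (List.suffix_cons _ _).trans hx
      have hxu : x <:+ u := (List.suffix_cons _ _).trans hx'
      have hsuf : ∀ j y, j :: y <:+ u → x.length ≤ y.length → x <:+ y := fun j y hy hxy =>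
        List.suffix_of_suffix_length_le hxu ((List.suffix_cons _ _).trans hy) hxy
      have hle : pathMax w u x.length ≤ pathMax w v x.length := by
        refine (pathMax_le_iff (pathMax_nonneg _ _ _)).2 fun j y hy hxy => ?_
        have := hu j y hy (not_suffix_of_branch hii hx hx' hy (hsuf j y hy hxy))
        rwa [meet_of_branch hii hx hx' ((List.suffix_cons _ _).trans hy) (hsuf j y hy hxy)] at this
      have heq := le_antisymm hle (hopt x List.nil_suffix hxv u hxu hul)
      obtain ⟨j, y, hy, hxy, hmax⟩ := exists_eq_pathMax hpos (v := u) (k := x.length)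
        (by simpa using hx'.length_le)
      obtain ⟨j', y', hy', hxy', hmax'⟩ := exists_eq_pathMax hpos (v := v) (k := x.length)
        (by simpa using hx.length_le)
      have := hinj ((hmax.symm.trans heq).trans hmax')
      obtain ⟨rfl, rfl⟩ := Prod.mk.inj this
      exact not_suffix_of_branch hii hx hx' hy (hsuf _ _ hy hxy) hy'
  exact ⟨v, S, hl, hS, hw⟩

end Spine

/-! ### Invasion up to a given height -/

section Invasion

variable {σ : ℕ}

lemma mem_edgeBoundary_of_closed {I : Set (Vertex σ)} (hI : ∀ i u, i :: u ∈ I → u ∈ I)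
    {e : Edge σ} : e ∈ edgeBoundary I ↔ e.1 ∈ I ∧ e.2 :: e.1 ∉ I := by
  have := hI e.2 e.1
  simp only [edgeBoundary, Set.mem_ofPred_eq, Xor]
  tauto

lemma invaded_closed (w : Edge σ → ℝ) (N : ℕ) : ∀ i u, i :: u ∈ invaded w N → u ∈ invaded w N := by
  induction N with
  | zero => simp [invaded]
  | succ N ih =>
    rintro i u (h | ⟨e, he, hmin, h | h⟩)
    · exact .inl (ih i u h)
    · exact .inl (ih i u (h ▸ ((mem_edgeBoundary_of_closed ih).1 he).1))
    · obtain ⟨rfl, rfl⟩ := List.cons.inj h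
      exact .inl ((mem_edgeBoundary_of_closed ih).1 he).1

lemma length_le_of_mem_invaded {w : Edge σ → ℝ} {N : ℕ} {u : Vertex σ} (hu : u ∈ invaded w N) :
    u.length ≤ N := by
  induction N generalizing u with
  | zero => simp [invaded] at hu; simp [hu]
  | succ N ih =>
    rcases hu with h | ⟨e, he, hmin, h | h⟩
    · exact (ih h).trans N.le_succ
    · have := ih ((mem_edgeBoundary_of_closed (invaded_closed w N)).1 he).1
      rw [h]; omega
    · have := ih ((mem_edgeBoundary_of_closed (invaded_closed w N)).1 he).1
      rw [h, List.length_cons]; omega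

lemma invaded_mono (w : Edge σ → ℝ) : Monotone (invaded w) :=
  monotone_nat_of_le_succ fun _ => Set.subset_union_left

lemma mem_of_suffix_of_mem_invaded {w : Edge σ → ℝ} {N : ℕ} {u x : Vertex σ} (hux : u <:+ x)
    (hx : x ∈ invaded w N) : u ∈ invaded w N := by
  by_contra hu
  obtain ⟨t, rfl⟩ := hux
  induction t with
  | nil => exact hu hx
  | cons i t ih => exact ih (invaded_closed w N i _ hx)

/-- The vertex `v` cannot be invaded in fewer steps than its height. Until then the path to `v` has
a boundary edge beyond the point where a candidate edge's branch leaves it, so an invaded edge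
weighs at most the path maximum from there and belongs to `S`. -/
lemma invaded_subset_of_mem_treeEvent {v : Vertex σ} {S : Finset (Vertex σ)}
    (hS : IsSpineTree v S) {w : Edge σ → ℝ} (hw : w ∈ treeEvent v S) {N : ℕ} (hN : N ≤ v.length) :
    invaded w N ⊆ S := by
  induction N with
  | zero =>
    rintro u hu
    rw [invaded, Set.mem_singleton_iff] at hu
    exact hu ▸ hS.nil_mem
  | succ N ih =>
    have hsub := ih (by omega)
    rintro u (hu | ⟨e, he, hmin, h | h⟩)
    · exact hsub hu
    · exact h ▸ hsub ((mem_edgeBoundary_of_closed (invaded_closed w N)).1 he).1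
    · obtain ⟨h1, h2⟩ := (mem_edgeBoundary_of_closed (invaded_closed w N)).1 he
      subst h
      by_contra hnot
      have hvN : v ∉ invaded w N := fun h => by
        have := length_le_of_mem_invaded h; omega
      obtain ⟨x, hxv, hxe, hxl⟩ := exists_suffix_meet v e.1
      obtain ⟨i, y, hy1, hy2, hy3, hy4⟩ :=
        exists_exit_edge hxv (mem_of_suffix_of_mem_invaded hxe h1) hvN
      have hle := hmin (y, i) ((mem_edgeBoundary_of_closed (invaded_closed w N)).2 ⟨hy3, hy4⟩)
      have hoff : e ∈ offEdges v S := by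
        refine mem_offEdges.2 ⟨hsub h1, ?_, fun h => hnot (hS.mem_of_suffix h hS.end_mem)⟩
        rintro h
        exact hvN (h ▸ h1)
      have hlt := (hw e hoff).not.2 hnot
      simp only [← hxl] at hlt
      exact hlt (hle.trans (le_pathMax hy1 hy2.length_le))

lemma measurable_invaded (N : ℕ) : Measurable fun w : Edge σ → ℝ => invaded w N := by
  induction N with
  | zero => exact measurable_const
  | succ N ih =>
    have hb : ∀ e : Edge σ, Measurable fun w : Edge σ → ℝ => e ∈ edgeBoundary (invaded w N) := by
      intro e
      simp only [mem_edgeBoundary_of_closed (invaded_closed _ N)]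
      exact (measurable_set_iff.1 ih _).and (measurable_set_iff.1 ih _).not
    refine measurable_set_iff.2 fun v => ?_
    simp only [invaded, Set.mem_union, Set.mem_ofPred_eq]
    refine (measurable_set_iff.1 ih v).or (Measurable.exists fun e => (hb e).and
      (Measurable.and (Measurable.forall fun f => (hb f).imp ?_) measurable_const))
    exact measurableSet_setOfPred.1
      (measurableSet_le (measurable_pi_apply e) (measurable_pi_apply f))

lemma measurable_ipc : Measurable (ipc : (Edge σ → ℝ) → Set (Vertex σ)) := by
  refine measurable_set_iff.2 fun v => ?_
  simp only [ipc, Set.mem_iUnion]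
  exact Measurable.exists fun N => measurable_set_iff.1 (measurable_invaded N) v

lemma eventually_mem_invaded_iff (w : Edge σ → ℝ) (v : Vertex σ) :
    ∀ᶠ N in atTop, v ∈ invaded w N ↔ v ∈ ipc w := by
  by_cases h : v ∈ ipc w
  · obtain ⟨N, hN⟩ := Set.mem_iUnion.1 h
    filter_upwards [eventually_ge_atTop N] with M hM
    exact iff_of_true (invaded_mono w hM hN) h
  · exact Eventually.of_forall fun N =>
      iff_of_false (fun h' => h (Set.mem_iUnion.2 ⟨N, h'⟩)) h

end Invasion

/-! ### Dual percolation -/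

section Odds

/-- The odds that an edge is open in the percolation with parameter `m` given that the branch of
height `k` below it does not reach its maximal height. -/
noncomputable def dualOdds (σ : ℕ) : ℕ → ℝ → ℝ
  | 0, _ => 0
  | k + 1, m => m * (1 - m) ^ (σ - 1) * (1 + dualOdds σ k m) ^ σ

/-- The probability with odds `dualOdds`. -/
noncomputable def dualRate (σ k : ℕ) (m : ℝ) : ℝ := dualOdds σ k m / (1 + dualOdds σ k m)

variable {σ : ℕ} {m : ℝ}

lemma dualOdds_nonneg (h0 : 0 ≤ m) (h1 : m ≤ 1) (k : ℕ) : 0 ≤ dualOdds σ k m := by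
  have : 0 ≤ 1 - m := by linarith
  induction k with
  | zero => exact le_rfl
  | succ k ih => rw [dualOdds]; positivity

/-- The maximum over `m` is attained at the critical value `1 / σ`. -/
lemma mul_one_sub_pow_le (hσ : 2 ≤ σ) (_h0 : 0 ≤ m) (h1 : m ≤ 1) :
    m * (1 - m) ^ (σ - 1) ≤ (1 / σ) * ((σ - 1) / σ : ℝ) ^ (σ - 1) := by
  obtain ⟨s, rfl⟩ : ∃ s, σ = s + 1 := ⟨σ - 1, by omega⟩
  have hs : (0 : ℝ) < s := by exact_mod_cast (by omega : 0 < s)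
  simp only [Nat.add_sub_cancel, Nat.cast_add, Nat.cast_one, add_sub_cancel_right]
  -- The inequality `x ≤ exp (x - 1)` is applied to two quantities that both equal 1 at `m = 1 / σ`;
  -- in the product below the exponents cancel.
  have ha : (s + 1) * m ≤ Real.exp ((s + 1) * m - 1) := by
    linarith [Real.add_one_le_exp ((s + 1) * m - 1)]
  have hb : (1 - m) * ((s + 1) / s) ≤ Real.exp ((1 - m) * ((s + 1) / s) - 1) := by
    linarith [Real.add_one_le_exp ((1 - m) * ((s + 1) / s) - 1)]
  have hb0 : 0 ≤ (1 - m) * ((s + 1) / s) := mul_nonneg (by linarith) (by positivity)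
  have hprod : (s + 1) * m * ((1 - m) * ((s + 1) / s)) ^ s ≤ 1 := by
    calc (s + 1) * m * ((1 - m) * ((s + 1) / s)) ^ s
        ≤ Real.exp ((s + 1) * m - 1) * Real.exp ((1 - m) * ((s + 1) / s) - 1) ^ s := by
          gcongr
      _ = 1 := by
          rw [← Real.exp_nat_mul, ← Real.exp_add, Real.exp_eq_one_iff]
          field_simp
          ring
  calc m * (1 - m) ^ s = (1 / (s + 1)) * (s / (s + 1)) ^ s
        * ((s + 1) * m * ((1 - m) * ((s + 1) / s)) ^ s) := by
        rw [mul_pow, div_pow, div_pow]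
        field_simp
    _ ≤ (1 / (s + 1)) * (s / (s + 1)) ^ s * 1 := by
        gcongr
    _ = _ := mul_one _

/-- The bound is the odds of `1 / σ`, a fixed point of the recursion at `m = 1 / σ`. There the
coefficient is largest, and the recursion is increasing in the odds. -/
lemma dualOdds_le (hσ : 2 ≤ σ) (h0 : 0 ≤ m) (h1 : m ≤ 1) (k : ℕ) :
    dualOdds σ k m ≤ 1 / (σ - 1) := by
  have hσ' : (2 : ℝ) ≤ σ := by exact_mod_cast hσ
  have hs : (0 : ℝ) < σ - 1 := by linarith
  induction k with
  | zero => rw [dualOdds]; positivity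
  | succ k ih =>
    rw [dualOdds]
    have h2 := dualOdds_nonneg (σ := σ) h0 h1 k
    have h3 : 0 ≤ m * (1 - m) ^ (σ - 1) := mul_nonneg h0 (pow_nonneg (by linarith) _)
    calc m * (1 - m) ^ (σ - 1) * (1 + dualOdds σ k m) ^ σ
        ≤ (1 / σ) * ((σ - 1) / σ : ℝ) ^ (σ - 1) * (1 + 1 / (σ - 1)) ^ σ := by
          refine mul_le_mul (mul_one_sub_pow_le hσ h0 h1) ?_ (by positivity) (h3.trans
            (mul_one_sub_pow_le hσ h0 h1))
          gcongr
      _ = 1 / (σ - 1) := by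
          have h4 : (1 + 1 / (σ - 1) : ℝ) = σ / (σ - 1) := by field_simp; ring
          have h5 : ((σ - 1) / σ : ℝ) ^ (σ - 1) * (σ / (σ - 1)) ^ (σ - 1) = 1 := by
            rw [← mul_pow, div_mul_div_cancel₀ (by linarith), div_self hs.ne', one_pow]
          rw [h4]
          conv_lhs => rw [show (σ / (σ - 1) : ℝ) ^ σ = (σ / (σ - 1)) ^ (σ - 1) * (σ / (σ - 1)) from by
            rw [← pow_succ, Nat.sub_add_cancel (by omega)]]
          calc (1 / σ) * ((σ - 1) / σ : ℝ) ^ (σ - 1) * ((σ / (σ - 1)) ^ (σ - 1) * (σ / (σ - 1)))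
              = (1 / σ) * (σ / (σ - 1)) *
                (((σ - 1) / σ : ℝ) ^ (σ - 1) * (σ / (σ - 1)) ^ (σ - 1)) := by ring
            _ = 1 / (σ - 1) := by rw [h5]; field_simp

lemma dualRate_nonneg (h0 : 0 ≤ m) (h1 : m ≤ 1) (k : ℕ) : 0 ≤ dualRate σ k m := by
  have := dualOdds_nonneg (σ := σ) h0 h1 k
  unfold dualRate
  positivity

/-- The source of the domination: whatever the original parameter, the dual edge probabilities do
not exceed the critical one. -/
lemma dualRate_le (hσ : 2 ≤ σ) (h0 : 0 ≤ m) (h1 : m ≤ 1) (k : ℕ) : dualRate σ k m ≤ 1 / σ := by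
  have hσ' : (2 : ℝ) ≤ σ := by exact_mod_cast hσ
  have h2 := dualOdds_nonneg (σ := σ) h0 h1 k
  have h3 := dualOdds_le hσ h0 h1 k
  rw [le_div_iff₀ (by linarith)] at h3
  rw [dualRate, div_le_div_iff₀ (by linarith) (by linarith)]
  linarith

@[simp] lemma dualRate_zero : dualRate σ 0 m = 0 := by simp [dualRate, dualOdds]

@[fun_prop]
lemma continuous_dualOdds (σ k : ℕ) : Continuous (dualOdds σ k) := by
  induction k with
  | zero => exact continuous_const
  | succ k ih => simp only [dualOdds]; fun_prop

lemma measurable_dualRate (σ k : ℕ) : Measurable (dualRate σ k) := by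
  have := (continuous_dualOdds σ k).measurable
  unfold dualRate
  fun_prop

/-- The factor that relates percolation with parameter `m` to the dual percolation. -/
noncomputable def dualFactor (σ k : ℕ) (m : ℝ) : ℝ := (1 - m) * (1 + dualOdds σ k m)

lemma dualFactor_pos (h0 : 0 ≤ m) (h1 : m < 1) (k : ℕ) : 0 < dualFactor σ k m := by
  have := dualOdds_nonneg (σ := σ) h0 h1.le k
  exact mul_pos (by linarith) (by linarith)

/-- `dualFactor σ k m` is the probability that an edge with `k` levels left does not lead to the
forbidden height. This identity is Bayes' rule for an open edge whose `σ` child edges all fail to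
lead there; `one_sub_eq_dual` is the rule for a closed edge. -/
lemma mul_dualFactor_pow [NeZero σ] (h0 : 0 ≤ m) (h1 : m ≤ 1) (k : ℕ) :
    m * dualFactor σ k m ^ σ = dualRate σ (k + 1) m * dualFactor σ (k + 1) m := by
  have h2 : 1 + dualOdds σ (k + 1) m ≠ 0 := by linarith [dualOdds_nonneg (σ := σ) h0 h1 (k + 1)]
  have h3 : dualRate σ (k + 1) m * dualFactor σ (k + 1) m = (1 - m) * dualOdds σ (k + 1) m := by
    rw [dualRate, dualFactor]
    field_simp
  obtain ⟨s, hs⟩ : ∃ s, σ = s + 1 := ⟨σ - 1, by have := NeZero.pos σ; omega⟩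
  rw [h3, dualOdds, dualFactor, mul_pow]
  have : (1 - m) ^ σ = (1 - m) * (1 - m) ^ (σ - 1) := by
    rw [← pow_succ', Nat.sub_add_cancel (NeZero.pos σ)]
  rw [this]
  ring

lemma one_sub_eq_dual (h0 : 0 ≤ m) (h1 : m ≤ 1) (k : ℕ) :
    1 - m = (1 - dualRate σ k m) * dualFactor σ k m := by
  have h2 : 1 + dualOdds σ k m ≠ 0 := by linarith [dualOdds_nonneg (σ := σ) h0 h1 k]
  rw [dualRate, dualFactor]
  field_simp
  ring

end Odds

/-! ### Duality for the branches off the spine -/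

section Identity

variable {σ : ℕ}

lemma prod_spine_children [NeZero σ] {v u : Vertex σ} (hu : u <:+ v) (hne : u ≠ v) (c : ℝ) :
    ∏ j : Fin σ, (if (u, j) ∉ spineEdges v then c else 1) = c ^ (σ - 1) := by
  have hlt : u.length < v.length :=
    lt_of_le_of_ne hu.length_le fun h => hne (hu.eq_of_length h)
  obtain ⟨i, x, hx, hl⟩ := exists_suffix_of_lt hlt
  have hxu : x = u := eq_of_suffix_of_suffix ((List.suffix_cons _ _).trans hx) hu hl
  subst hxu
  have : ∀ j, (x, j) ∉ spineEdges v ↔ j ≠ i := by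
    intro j
    rw [mem_spineEdges, not_iff_not]
    constructor
    · intro h
      exact (List.cons.inj (eq_of_suffix_of_suffix h hx rfl)).1
    · rintro rfl
      exact hx
  simp only [this]
  rw [Finset.prod_ite, Finset.prod_const_one, mul_one, Finset.prod_const, Finset.filter_ne',
    Finset.card_erase_of_mem (Finset.mem_univ _), Finset.card_univ, Fintype.card_fin]

/-- The probabilities of the off-spine configurations in percolation with parameters `m`, compared
to those in the dual percolation. -/
theorem prod_offEdges_eq [NeZero σ] {v : Vertex σ} {S : Finset (Vertex σ)} (hS : IsSpineTree v S)
    {m : ℕ → ℝ} (h0 : ∀ k, 0 ≤ m k) (h1 : ∀ k, m k < 1) :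
    (∏ e ∈ offEdges v S, if e.2 :: e.1 ∈ S then m (meet v e.1) else 1 - m (meet v e.1))
      = (∏ h ∈ Finset.range v.length, dualFactor σ (v.length - 1 - h) (m h) ^ (σ - 1)) *
        ∏ e ∈ offEdges v S, if e.2 :: e.1 ∈ S
          then dualRate σ (v.length - 1 - e.1.length) (m (meet v e.1))
          else 1 - dualRate σ (v.length - 1 - e.1.length) (m (meet v e.1)) := by
  set f : Vertex σ → ℝ := fun u => dualFactor σ (v.length - 1 - u.length) (m (meet v u)) with hf
  have hfpos : ∀ u, 0 < f u := fun u => dualFactor_pos (h0 _) (h1 _) _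
  -- Each edge trades a factor `f ^ σ` at its lower-level dual side, the child in `S`, for a factor
  -- `f` at the parent.
  have hedge : ∀ e ∈ offEdges v S,
      (if e.2 :: e.1 ∈ S then m (meet v e.1) else 1 - m (meet v e.1)) *
        (if e.2 :: e.1 ∈ S then f (e.2 :: e.1) ^ σ else 1)
      = (if e.2 :: e.1 ∈ S then dualRate σ (v.length - 1 - e.1.length) (m (meet v e.1))
          else 1 - dualRate σ (v.length - 1 - e.1.length) (m (meet v e.1))) * f e.1 := by
    rintro ⟨u, i⟩ he
    obtain ⟨hu1, hu2, hu3⟩ := mem_offEdges.1 he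
    simp only at hu1 hu2 hu3 ⊢
    split_ifs with hS'
    · have hl : (i :: u).length < v.length :=
        (hS.height _ hS').resolve_right fun h => hu3 (h ▸ List.suffix_refl _)
      rw [List.length_cons] at hl
      rw [hf]
      simp only [List.length_cons, meet_cons_of_not_suffix hu3]
      rw [show v.length - 1 - u.length = v.length - 1 - (u.length + 1) + 1 by omega]
      exact mul_dualFactor_pow (h0 _) (h1 _).le _
    · rw [mul_one]
      exact one_sub_eq_dual (h0 _) (h1 _).le _
  have hprod := Finset.prod_congr (rfl : offEdges v S = _) hedge
  rw [Finset.prod_mul_distrib, Finset.prod_mul_distrib] at hprod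
  have hG : (∏ e ∈ offEdges v S, if e.2 :: e.1 ∈ S then f (e.2 :: e.1) ^ σ else 1)
      = ∏ u ∈ S.filter (fun u => ¬ u <:+ v), f u ^ σ := by
    rw [← Finset.prod_filter]
    refine Finset.prod_bij (fun e _ => e.2 :: e.1) ?_ ?_ ?_ (fun _ _ => rfl)
    · intro e he
      rw [Finset.mem_filter] at he ⊢
      exact ⟨he.2, (mem_offEdges.1 he.1).2.2⟩
    · rintro ⟨u, i⟩ - ⟨u', i'⟩ - h
      obtain ⟨h1, h2⟩ := List.cons.inj h
      exact Prod.ext h2 h1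
    · intro u hu
      rw [Finset.mem_filter] at hu
      cases u with
      | nil => exact absurd List.nil_suffix hu.2
      | cons i u =>
        refine ⟨(u, i), Finset.mem_filter.2 ⟨mem_offEdges.2 ⟨hS.mem_of_cons _ _ hu.1, ?_, hu.2⟩,
          hu.1⟩, rfl⟩
        rintro rfl
        simpa using hS.height _ hu.1
  -- An off-path vertex of `S` has `σ` outgoing edges, whose factors cancel those of its incoming
  -- edge. A path vertex has only `σ - 1` off-path edges and no off-path incoming edge, so its
  -- factor survives.
  have hF : (∏ e ∈ offEdges v S, f e.1)
      = (∏ h ∈ Finset.range v.length, dualFactor σ (v.length - 1 - h) (m h) ^ (σ - 1)) *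
        ∏ u ∈ S.filter (fun u => ¬ u <:+ v), f u ^ σ := by
    rw [offEdges, Finset.prod_filter, Finset.prod_product,
      ← Finset.prod_filter_mul_prod_filter_not (S.erase v) (fun u => u <:+ v)]
    congr 1
    · refine Finset.prod_bij (fun u _ => u.length) ?_ ?_ ?_ ?_
      · intro u hu
        rw [Finset.mem_filter, Finset.mem_erase] at hu
        rw [Finset.mem_range]
        exact lt_of_le_of_ne hu.2.length_le fun h => hu.1.1 (hu.2.eq_of_length h)
      · intro u hu u' hu' h
        rw [Finset.mem_filter] at hu hu'
        exact eq_of_suffix_of_suffix hu.2 hu'.2 h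
      · intro h hh
        obtain ⟨i, u, hu, hl⟩ := exists_suffix_of_lt (Finset.mem_range.1 hh)
        have hu' : u <:+ v := (List.suffix_cons _ _).trans hu
        refine ⟨u, Finset.mem_filter.2 ⟨Finset.mem_erase.2 ⟨?_, hS.mem_of_suffix hu' hS.end_mem⟩,
          hu'⟩, hl⟩
        rintro rfl
        simpa using hu.length_le
      · intro u hu
        rw [Finset.mem_filter, Finset.mem_erase] at hu
        refine (prod_spine_children hu.2 hu.1.1 (f u)).trans ?_
        simp only [hf, meet_of_suffix hu.2]
    · have : (S.erase v).filter (fun u => ¬ u <:+ v) = S.filter (fun u => ¬ u <:+ v) := by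
        ext u
        simp only [Finset.mem_filter, Finset.mem_erase]
        constructor
        · exact fun h => ⟨h.1.2, h.2⟩
        · exact fun h => ⟨⟨fun huv => h.2 (huv ▸ List.suffix_refl _), h.1⟩, h.2⟩
      rw [this]
      refine Finset.prod_congr rfl fun u hu => ?_
      rw [Finset.mem_filter] at hu
      rw [Finset.prod_congr rfl (g := fun _ => f u), Finset.prod_const, Finset.card_univ,
        Fintype.card_fin]
      intro j _
      rw [if_pos]
      rw [mem_spineEdges]
      exact fun h => hu.2 ((List.suffix_cons _ _).trans h)
  rw [hG, hF] at hprod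
  have hpos : 0 < ∏ u ∈ S.filter (fun u => ¬ u <:+ v), f u ^ σ :=
    Finset.prod_pos fun u _ => pow_pos (hfpos u) _
  refine mul_right_cancel₀ hpos.ne' (hprod.trans ?_)
  ring

end Identity

/-! ### Resampling the weights on the spine -/

section Resample

variable {σ : ℕ}

/-- The law of independent uniform weights that are indexed by the heights. -/
noncomputable def heightLaw : Measure (ℕ → ℝ) := Measure.infinitePi fun _ => uniform01

instance : IsProbabilityMeasure heightLaw := by unfold heightLaw; infer_instance

/-- The weights `w` with those on the path to `v` replaced by `y`. -/
def overwrite (v : Vertex σ) (p : (ℕ → ℝ) × (Edge σ → ℝ)) : Edge σ → ℝ :=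
  fun e => if e ∈ spineEdges v then p.1 e.1.length else p.2 e

lemma measurable_overwrite (v : Vertex σ) : Measurable (overwrite v) := by
  refine measurable_pi_iff.2 fun e => ?_
  unfold overwrite
  split_ifs <;> fun_prop

/-- `overwrite v` reads distinct coordinates of an i.i.d. family. It makes the path weights a
separate variable indexed by height, in a form that is the same for every `v`. -/
lemma map_overwrite (v : Vertex σ) :
    (heightLaw.prod (weightLaw σ)).map (overwrite v) = weightLaw σ := by
  set φ : Edge σ → ℕ ⊕ Edge σ := fun e =>
    if e ∈ spineEdges v then .inl e.1.length else .inr e with hφ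
  have hinj : Function.Injective φ := by
    intro e e' h
    simp only [hφ] at h
    split_ifs at h with h1 h2 h2
    · rw [mem_spineEdges] at h1 h2
      have := List.cons.inj (eq_of_suffix_of_suffix h1 h2 (by simpa using Sum.inl.inj h))
      exact Prod.ext this.2 this.1
    · exact Sum.inr.inj h
  have h1 := Measure.map_infinitePi_infinitePi_of_inj (P := fun _ : ℕ ⊕ Edge σ => uniform01) hinj
  have hmeas : Measurable fun p : (ℕ → ℝ) × (Edge σ → ℝ) => (Sum.elim p.1 p.2 : ℕ ⊕ Edge σ → ℝ) := by
    refine measurable_pi_iff.2 fun a => ?_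
    rcases a with a | a
    · exact (measurable_pi_apply a).comp measurable_fst
    · exact (measurable_pi_apply a).comp measurable_snd
  rw [← infinitePi_prod_map_sumElim, Measure.map_map (by fun_prop) hmeas] at h1
  refine Eq.trans ?_ h1
  refine congrArg (fun g => Measure.map g (heightLaw.prod (weightLaw σ))) ?_
  funext p e
  simp only [overwrite, Function.comp_apply, hφ]
  split_ifs <;> rfl

lemma spineWeight_overwrite (v : Vertex σ) (p : (ℕ → ℝ) × (Edge σ → ℝ)) {j : ℕ}
    (hj : j < v.length) : spineWeight (overwrite v p) v j = p.1 j := by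
  obtain ⟨i, u, hu, rfl⟩ := exists_suffix_of_lt hj
  rw [spineWeight_of_suffix hu, overwrite, if_pos (mem_spineEdges.2 hu)]

lemma overwrite_preimage_treeEvent (v : Vertex σ) (S : Finset (Vertex σ)) :
    overwrite v ⁻¹' treeEvent v S
      = {p | p.2 ∈ spineEvent v S fun e => tailMax p.1 (meet v e.1) v.length} := by
  ext p
  simp only [Set.mem_preimage, treeEvent, spineEvent, Set.mem_ofPred_eq]
  refine forall₂_congr fun e he => ?_
  rw [overwrite, if_neg (fun h => (mem_offEdges.1 he).2.2 (mem_spineEdges.1 h)), pathMax,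
    tailMax_congr fun j hj => spineWeight_overwrite v p hj]

lemma measurable_tailMax {Ω : Type*} [MeasurableSpace Ω] {y : Ω → ℕ → ℝ}
    (hy : ∀ j, Measurable fun ω => y ω j) (k n : ℕ) : Measurable fun ω => tailMax (y ω) k n := by
  induction n with
  | zero => exact measurable_const
  | succ n ih =>
    simp only [tailMax]
    refine ih.max ?_
    split_ifs
    · exact hy n
    · exact measurable_const

lemma measurable_spineWeight (v : Vertex σ) (j : ℕ) :
    Measurable fun w : Edge σ → ℝ => spineWeight w v j := by
  induction v with
  | nil => exact measurable_const
  | cons i u ih =>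
    simp only [spineWeight]
    split_ifs
    · exact measurable_pi_apply _
    · exact ih

lemma measurableSet_spineEvent {Ω : Type*} [MeasurableSpace Ω] (v : Vertex σ)
    (S : Finset (Vertex σ)) {x t : Ω → Edge σ → ℝ} (hx : ∀ e, Measurable fun ω => x ω e)
    (ht : ∀ e, Measurable fun ω => t ω e) : MeasurableSet {ω | x ω ∈ spineEvent v S (t ω)} := by
  simp only [spineEvent, Set.mem_ofPred_eq]
  exact measurableSet_setOfPred.2 (Measurable.forall fun e => Measurable.imp measurable_const
    (Measurable.iff (measurableSet_setOfPred.1 (measurableSet_le (hx e) (ht e))) measurable_const))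

lemma measurableSet_treeEvent (v : Vertex σ) (S : Finset (Vertex σ)) :
    MeasurableSet (treeEvent v S) :=
  measurableSet_spineEvent v S (fun e => measurable_pi_apply e) fun _ =>
    measurable_tailMax (fun j => measurable_spineWeight v j) _ _

lemma weightLaw_spineEvent (v : Vertex σ) (S : Finset (Vertex σ)) {t : Edge σ → ℝ}
    (h0 : ∀ e, 0 ≤ t e) (h1 : ∀ e, t e ≤ 1) :
    weightLaw σ (spineEvent v S t)
      = ENNReal.ofReal (∏ e ∈ offEdges v S, if e.2 :: e.1 ∈ S then t e else 1 - t e) := by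
  rw [spineEvent, weightLaw_box _ (fun e => e.2 :: e.1 ∈ S) (fun e _ => h0 e) fun e _ => h1 e]
  congr 1
  refine Finset.prod_congr rfl fun e _ => ?_
  split_ifs <;> rfl

/-- Conditioning on the path weights turns the thresholds into constants, and the event concerns
only the independent weights off the path. -/
lemma weightLaw_treeEvent (v : Vertex σ) (S : Finset (Vertex σ)) :
    weightLaw σ (treeEvent v S) = ∫⁻ y, weightLaw σ
      (spineEvent v S fun e => tailMax y (meet v e.1) v.length) ∂heightLaw := by
  conv_lhs => rw [← map_overwrite v]
  rw [Measure.map_apply (measurable_overwrite v) (measurableSet_treeEvent v S),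
    Measure.prod_apply (measurable_overwrite v (measurableSet_treeEvent v S)),
    overwrite_preimage_treeEvent]
  rfl

end Resample

/-! ### The coupling up to a given height -/

section Coupling

variable {σ : ℕ}

/-- The parameters of the dual percolation off the path to `v` given the weights `y` on the path. -/
noncomputable def dualThreshold (v : Vertex σ) (y : ℕ → ℝ) (e : Edge σ) : ℝ :=
  dualRate σ (v.length - 1 - e.1.length) (tailMax y (meet v e.1) v.length)

/-- The density of the weights on the spine of the invaded cluster. -/
noncomputable def spineDensity (σ n : ℕ) (y : ℕ → ℝ) : ℝ :=
  σ ^ n * ∏ h ∈ Finset.range n, dualFactor σ (n - 1 - h) (tailMax y h n) ^ (σ - 1)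

variable (σ) in
/-- The joint law of the weights on the spine, of the ray and of the weights off the spine. -/
noncomputable def spineLaw (n : ℕ) : Measure ((ℕ → ℝ) × (ℕ → Fin σ) × (Edge σ → ℝ)) :=
  (heightLaw.withDensity fun y => ENNReal.ofReal (spineDensity σ n y)).prod
    ((rayLaw σ).prod (weightLaw σ))

/-- The counterpart of `treeEvent` under `spineLaw`. -/
def dualTreeEvent (v : Vertex σ) (S : Finset (Vertex σ)) :
    Set ((ℕ → ℝ) × (ℕ → Fin σ) × (Edge σ → ℝ)) :=
  {p | rayVertex p.2.1 v.length = v ∧ p.2.2 ∈ spineEvent v S (dualThreshold v p.1)}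

lemma measurable_dualThreshold {Ω : Type*} [MeasurableSpace Ω] {y : Ω → ℕ → ℝ}
    (hy : ∀ j, Measurable fun ω => y ω j) (v : Vertex σ) (e : Edge σ) :
    Measurable fun ω => dualThreshold v (y ω) e :=
  (measurable_dualRate _ _).comp (measurable_tailMax hy _ _)

lemma measurable_spineDensity (n : ℕ) : Measurable (spineDensity σ n) := by
  have : ∀ h, Measurable fun y : ℕ → ℝ => tailMax y h n := fun h =>
    measurable_tailMax (fun j => measurable_pi_apply j) _ _
  have hf : ∀ k, Measurable (dualFactor σ k) := fun k => by
    have := (continuous_dualOdds σ k).measurable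
    unfold dualFactor
    fun_prop
  unfold spineDensity
  exact measurable_const.mul (Finset.measurable_prod _ fun h _ => ((hf _).comp (this h)).pow_const _)

lemma measurableSet_dualTreeEvent (v : Vertex σ) (S : Finset (Vertex σ)) :
    MeasurableSet (dualTreeEvent v S) := by
  refine MeasurableSet.inter ?_ ?_
  · exact (measurable_fst.comp measurable_snd) (measurableSet_rayVertex_eq _ v)
  · refine measurableSet_spineEvent v S (fun e => ?_) fun e => measurable_dualThreshold (fun j => ?_) v e
    · exact (measurable_pi_apply e).comp (measurable_snd.comp measurable_snd)
    · exact (measurable_pi_apply j).comp measurable_fst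

lemma ae_heightLaw : ∀ᵐ y ∂heightLaw, ∀ j, y j ∈ Set.Ioo (0 : ℝ) 1 := ae_infinitePi_uniform01

/-- The tree found by invasion has the law of the tree formed by a uniform path and by branches of
dual percolation. -/
theorem weightLaw_treeEvent_eq_spineLaw [NeZero σ] {v : Vertex σ} {S : Finset (Vertex σ)}
    (hS : IsSpineTree v S) :
    weightLaw σ (treeEvent v S) = spineLaw σ v.length (dualTreeEvent v S) := by
  have hσ : (0 : ℝ) < σ := by exact_mod_cast NeZero.pos σ
  have hd : Measurable fun y => ENNReal.ofReal (spineDensity σ v.length y) :=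
    (measurable_spineDensity v.length).ennreal_ofReal
  rw [weightLaw_treeEvent, spineLaw, Measure.prod_apply (measurableSet_dualTreeEvent v S),
    lintegral_withDensity_eq_lintegral_mul _ hd
      (measurable_measure_prodMk_left (measurableSet_dualTreeEvent v S))]
  refine lintegral_congr_ae ?_
  filter_upwards [ae_heightLaw] with y hy
  have hm0 : ∀ k, 0 ≤ tailMax y k v.length := fun k => tailMax_nonneg _ _ _
  have hm1 : ∀ k, tailMax y k v.length < 1 := fun k => tailMax_lt_one fun j => (hy j).2
  have hpre : Prod.mk y ⁻¹' dualTreeEvent v S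
      = {b | rayVertex b v.length = v} ×ˢ spineEvent v S (dualThreshold v y) := rfl
  have hr1 : ∀ k m, 0 ≤ m → m ≤ 1 → dualRate σ k m ≤ 1 := fun k m h0 h1 =>
    div_le_one_of_le₀ (by linarith) (by linarith [dualOdds_nonneg (σ := σ) h0 h1 k])
  have hF : 0 ≤ ∏ h ∈ Finset.range v.length,
      dualFactor σ (v.length - 1 - h) (tailMax y h v.length) ^ (σ - 1) :=
    Finset.prod_nonneg fun h _ => (pow_pos (dualFactor_pos (hm0 h) (hm1 h) _) _).le
  rw [Pi.mul_apply, hpre, Measure.prod_prod, rayLaw_rayVertex_eq,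
    weightLaw_spineEvent v S (fun e => hm0 _) (fun e => (hm1 _).le),
    weightLaw_spineEvent v S (t := dualThreshold v y) (fun e => dualRate_nonneg (hm0 _) (hm1 _).le _)
      (fun e => hr1 _ _ (hm0 _) (hm1 _).le), prod_offEdges_eq hS hm0 hm1,
    ← ENNReal.ofReal_mul (by positivity), ← ENNReal.ofReal_mul (by unfold spineDensity; positivity)]
  congr 1
  -- The factor `σ ^ n` of the density cancels the probability that the uniform ray passes through
  -- `v`.
  rw [spineDensity, mul_comm ((σ : ℝ) ^ v.length), mul_assoc, ← mul_assoc ((σ : ℝ) ^ v.length),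
    ← mul_pow, mul_one_div_cancel hσ.ne', one_pow, one_mul]
  rfl

lemma eq_of_mem_dualTreeEvent {v v' : Vertex σ} {S S' : Finset (Vertex σ)}
    (hl : v.length = v'.length) (hS : IsSpineTree v S) (hS' : IsSpineTree v' S')
    {p : (ℕ → ℝ) × (ℕ → Fin σ) × (Edge σ → ℝ)} (hp : p ∈ dualTreeEvent v S)
    (hp' : p ∈ dualTreeEvent v' S') : v = v' ∧ S = S' := by
  have hv : v = v' := by rw [← hp.1, ← hp'.1, hl]
  subst hv
  exact ⟨rfl, eq_of_mem_spineEvent hS hS' hp.2 hp'.2⟩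

lemma exists_mem_dualTreeEvent {p : (ℕ → ℝ) × (ℕ → Fin σ) × (Edge σ → ℝ)}
    (hp : ∀ e, 0 < p.2.2 e) (n : ℕ) :
    ∃ v S, v.length = n ∧ IsSpineTree v S ∧ p ∈ dualTreeEvent v S := by
  obtain ⟨S, hS, hw⟩ := exists_spineTree (v := rayVertex p.2.1 n) (x := p.2.2)
    (t := dualThreshold (rayVertex p.2.1 n) p.1) fun u hul hu => by
      by_contra hne
      cases u with
      | nil => exact hne (List.length_eq_zero_iff.1 hul.symm).symm
      | cons i y =>
        have := hu i y (List.suffix_refl _) fun h => hne (h.eq_of_length hul)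
        rw [List.length_cons] at hul
        -- An edge into the top height has no levels left, so its threshold is 0, below every
        -- positive weight.
        rw [dualThreshold, ← hul, Nat.add_sub_cancel, Nat.sub_self, dualRate_zero] at this
        exact (hp _).not_ge this
  exact ⟨_, S, length_rayVertex _ _, hS, by rw [length_rayVertex], hw⟩

lemma subset_cluster_of_mem_dualTreeEvent (hσ : 2 ≤ σ) {v : Vertex σ} {S : Finset (Vertex σ)}
    (hS : IsSpineTree v S) {p : (ℕ → ℝ) × (ℕ → Fin σ) × (Edge σ → ℝ)}
    (hy : ∀ j, p.1 j ∈ Set.Ioo (0 : ℝ) 1) (hp : p ∈ dualTreeEvent v S) :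
    (S : Set (Vertex σ)) ⊆ cluster (iicConfig p.2) := by
  intro u hu
  refine mem_cluster_iff_forall_suffix.2 fun i y hyu => ?_
  have hiy : i :: y ∈ S := hS.mem_of_suffix hyu hu
  by_cases hs : i :: y <:+ v
  · refine .inl ((mem_rayEdges_iff (n := v.length) ?_).2 ?_)
    · simpa using hs.length_le
    · rw [hp.1]
      exact mem_spineEdges.2 hs
  · refine .inr ?_
    have hne : y ≠ v := by
      rintro rfl
      simpa using hS.height _ hiy
    have := (hp.2 (y, i) (mem_offEdges.2 ⟨hS.mem_of_cons _ _ hiy, hne, hs⟩)).2 hiy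
    exact this.trans (dualRate_le hσ (tailMax_nonneg _ _ _) (tailMax_lt_one fun j => (hy j).2).le _)

lemma IsCoupling.map {α β α' β' : Type*} [MeasurableSpace α] [MeasurableSpace β]
    [MeasurableSpace α'] [MeasurableSpace β'] {γ : Measure (α × β)} {μ : Measure α} {ν : Measure β}
    (h : IsCoupling γ μ ν) {f : α → α'} {g : β → β'} (hf : Measurable f) (hg : Measurable g) :
    IsCoupling (γ.map (Prod.map f g)) (μ.map f) (ν.map g) := by
  have := h.isProbabilityMeasure
  refine ⟨Measure.isProbabilityMeasure_map (hf.prodMap hg).aemeasurable, ?_, ?_⟩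
  · rw [← h.fst_eq, Measure.map_map measurable_fst (hf.prodMap hg), Measure.map_map hf measurable_fst]
    rfl
  · rw [← h.snd_eq, Measure.map_map measurable_snd (hf.prodMap hg), Measure.map_map hg measurable_snd]
    rfl

/-- The pairs `(v, S)` with `v` of height `n` index partitions, up to null sets, of both spaces into
events of equal probability. On matched events, `S` contains `invaded w n` and is contained in the
IIC. -/
theorem exists_coupling_invaded (hσ : 2 ≤ σ) (n : ℕ) :
    ∃ γ : Measure (Set (Vertex σ) × Set (Vertex σ)),
      IsCoupling γ ((weightLaw σ).map fun w => invaded w n) (clusterLaw (iicMeasure σ)) ∧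
      ∀ᵐ c ∂γ, c.1 ⊆ c.2 := by
  have : NeZero σ := ⟨by omega⟩
  let ι := {q : Vertex σ × Finset (Vertex σ) // q.1.length = n ∧ IsSpineTree q.1 q.2}
  have hAc : weightLaw σ (⋃ q : ι, treeEvent q.1.1 q.1.2)ᶜ = 0 := by
    refine mem_ae_iff.1 ?_
    filter_upwards [ae_injective_weightLaw (σ := σ), ae_infinitePi_uniform01 (ι := Edge σ)]
      with w hinj hw
    obtain ⟨v, S, hl, hS, hmem⟩ := exists_mem_treeEvent hinj (fun e => (hw e).1) n
    exact Set.mem_iUnion.2 ⟨⟨(v, S), hl, hS⟩, hmem⟩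
  have hpos : ∀ᵐ p ∂(spineLaw σ n), ∀ e, 0 < p.2.2 e := by
    have h1 : ∀ᵐ q ∂((rayLaw σ).prod (weightLaw σ)), ∀ e, 0 < q.2 e :=
      Measure.quasiMeasurePreserving_snd.ae
        ((ae_infinitePi_uniform01 (ι := Edge σ)).mono fun w hw e => (hw e).1)
    exact Measure.quasiMeasurePreserving_snd.ae h1
  have hBc : spineLaw σ n (⋃ q : ι, dualTreeEvent q.1.1 q.1.2)ᶜ = 0 := by
    refine mem_ae_iff.1 ?_
    filter_upwards [hpos] with p hp
    obtain ⟨v, S, hl, hS, hmem⟩ := exists_mem_dualTreeEvent hp n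
    exact Set.mem_iUnion.2 ⟨⟨(v, S), hl, hS⟩, hmem⟩
  have hfin : SFinite (heightLaw.withDensity fun y => ENNReal.ofReal (spineDensity σ n y)) :=
    inferInstance
  have hprod : SFinite ((rayLaw σ).prod (weightLaw σ)) := inferInstance
  have hsf : SFinite (spineLaw σ n) := by unfold spineLaw; infer_instance
  obtain ⟨γ, hγ, hae⟩ := exists_coupling_of_partition (weightLaw σ) (spineLaw σ n)
    (A := fun q : ι => treeEvent q.1.1 q.1.2) (B := fun q : ι => dualTreeEvent q.1.1 q.1.2)
    (fun q => measurableSet_treeEvent _ _) (fun q => measurableSet_dualTreeEvent _ _)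
    (fun q q' hne => Set.disjoint_left.2 fun w h h' => hne (Subtype.ext (Prod.ext_iff.2
      (eq_of_mem_treeEvent (q.2.1.trans q'.2.1.symm) q.2.2 q'.2.2 h h'))))
    (fun q q' hne => Set.disjoint_left.2 fun p h h' => hne (Subtype.ext (Prod.ext_iff.2
      (eq_of_mem_dualTreeEvent (q.2.1.trans q'.2.1.symm) q.2.2 q'.2.2 h h'))))
    hAc hBc (fun q => by
      obtain ⟨⟨v, S⟩, rfl, hS⟩ := q
      exact weightLaw_treeEvent_eq_spineLaw hS)
  have hγp := hγ.isProbabilityMeasure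
  have hmf : Measurable fun w : Edge σ → ℝ => invaded w n := measurable_invaded n
  have hmg : Measurable fun p : (ℕ → ℝ) × (ℕ → Fin σ) × (Edge σ → ℝ) =>
      cluster (iicConfig p.2) := measurable_cluster.comp (measurable_iicConfig.comp measurable_snd)
  have hQ : (spineLaw σ n).map (fun p => cluster (iicConfig p.2)) = clusterLaw (iicMeasure σ) := by
    -- That `spineDensity` integrates to 1 is not computed but inherited from the coupling. The ray
    -- and the weights therefore have exactly the law that defines `iicMeasure`.
    have hprob : IsProbabilityMeasure (spineLaw σ n) := by
      rw [← hγ.snd_eq]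
      exact Measure.isProbabilityMeasure_map measurable_snd.aemeasurable
    have h1 : (heightLaw.withDensity fun y => ENNReal.ofReal (spineDensity σ n y)) Set.univ = 1 := by
      have := hprob.measure_univ
      rwa [spineLaw, ← Set.univ_prod_univ, Measure.prod_prod, measure_univ (μ := (rayLaw σ).prod _),
        mul_one] at this
    have h2 : (spineLaw σ n).map Prod.snd = (rayLaw σ).prod (weightLaw σ) := by
      rw [spineLaw, Measure.map_snd_prod, h1, one_smul]
    rw [clusterLaw, iicMeasure, ← h2, Measure.map_map measurable_iicConfig measurable_snd,
      Measure.map_map measurable_cluster (measurable_iicConfig.comp measurable_snd)]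
    rfl
  refine ⟨γ.map (Prod.map (fun w => invaded w n) fun p => cluster (iicConfig p.2)), ?_, ?_⟩
  · rw [← hQ]
    exact hγ.map hmf hmg
  · rw [ae_map_iff (hmf.prodMap hmg).aemeasurable
      (measurableSet_setOfPred.2 (measurable_fst.subset measurable_snd))]
    have hy : ∀ᵐ p ∂(spineLaw σ n), ∀ j, p.1 j ∈ Set.Ioo (0 : ℝ) 1 :=
      Measure.quasiMeasurePreserving_fst.ae
        ((withDensity_absolutelyContinuous _ _).ae_le ae_heightLaw)
    rw [← hγ.snd_eq] at hy
    filter_upwards [hae, ae_of_ae_map measurable_snd.aemeasurable hy] with p ⟨q, h1, h2⟩ h3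
    exact (invaded_subset_of_mem_treeEvent q.2.2 h1 q.2.1.ge).trans
      (subset_cluster_of_mem_dualTreeEvent hσ q.2.2 h3 h2)

end Coupling

end RegularTree

theorem theorem1p1 (σ : ℕ) (hσ : 2 ≤ σ) :
    (∃ ν : Measure (Set (RegularTree.Edge σ)), RegularTree.IsIICMeasure σ ν) ∧
    ∀ ν : Measure (Set (RegularTree.Edge σ)), RegularTree.IsIICMeasure σ ν →
      ∃ γ : Measure (Set (RegularTree.Vertex σ) × Set (RegularTree.Vertex σ)),
        RegularTree.IsCoupling γ (RegularTree.ipcLaw σ) (RegularTree.clusterLaw ν) ∧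
        ∀ᵐ c ∂γ, c.1 ⊆ c.2 := by
  have hiic := RegularTree.isIICMeasure_iicMeasure hσ
  refine ⟨⟨_, hiic⟩, fun ν hν => ?_⟩
  rw [hν.unique hiic]
  exact RegularTree.exists_coupling_of_tendsto _ RegularTree.measurable_invaded
    RegularTree.measurable_ipc RegularTree.eventually_mem_invaded_iff _
    (RegularTree.exists_coupling_invaded hσ)
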